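/- For a prime $p$, a subgroup $\mathcal G$ of $\mathbb F_p^*$ and $\lambda\in\mathbb F_p^*$, let $E^\times(\mathcal G+\lambda)$ denote the multiplicative energy of $\mathcal G+\lambda=\{g+\lambda : g\in\mathcal G\}\subseteq\mathbb F_p$, that is, the number of quadruples $(u_1,u_2,v_1,v_2)\in(\mathcal G+\lambda)^4$ with $u_1v_1=u_2v_2$. There is an absolute constant $C>0$ such that for every prime $p$, every subgroup $\mathcal G$ of $\mathbb F_p^*$ and every $\lambda\in\mathbb F_p^*$, $$ \left|E^\times(\mathcal G+\lambda)-\frac{|\mathcal G|^4}{p}\right|\le C\cdot \begin{cases} p^{1/2}|\mathcal G|^{3/2}, & \text{if } |\mathcal G|\ge p^{2/3},\\ |\mathcal G|^3p^{-1/2}, & \text{if } p^{2/3}>|\mathcal G|\ge p^{1/2}\log p,\\ |\mathcal G|^2\log|\mathcal G|, & \text{if } 2\le |\mathcal G|<p^{1/2}\log p, \end{cases} $$ where each of the three bounds holds whenever its condition is satisfied. Moreover, if $(p_n)$ is a sequence of primes, $\mathcal G_n$ is a subgroup of $\mathbb F_{p_n}^*$ and $\lambda_n\in\mathbb F_{p_n}^*$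 for each $n$, and $|\mathcal G_n|/\sqrt{p_n\log p_n}\to\infty$ as $n\to\infty$, then $$ E^\times(\mathcal G_n+\lambda_n)\sim\frac{|\mathcal G_n|^4}{p_n}\qquad(n\to\infty). $$ -/

import Mathlib

open Filter Asymptotics
open scoped Classical in
/-- The shifted subgroup `G + lam = {g + lam : g ∈ G}`, as a finite subset of `𝔽_p`. -/
noncomputable def shiftedSubgroup {p : ℕ} [Fact p.Prime] (G : Subgroup (ZMod p)ˣ)
    (lam : ZMod p) : Finset (ZMod p) :=
  {x | ∃ g ∈ G, x = (g : ZMod p) + lam}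

/-- The multiplicative energy of `G + lam`: the number of quadruples `u₁, u₂, v₁, v₂ ∈ G + lam`
with `u₁ * v₁ = u₂ * v₂` in `𝔽_p`. -/
noncomputable def shiftedEnergy {p : ℕ} [Fact p.Prime] (G : Subgroup (ZMod p)ˣ)
    (lam : ZMod p) : ℕ :=
  Finset.mulEnergy (shiftedSubgroup G lam) (shiftedSubgroup G lam)

/-!
Let `n = |G|`, so that `G` consists of the `n`-th roots of unity in `𝔽_p`. The energy of `G + λ`
is the second moment of the number `R(ρ)` of solutions of `x + λ = ρ (y + λ)` with `x, y ∈ G`, up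
to an explicit correction for the degenerate solutions (`mulEnergy_eq_sum_ratioCount_sq_add`). For
`ρ ≠ 0, 1` the equation is that of a line `a x + b y = 1`, and the number `M` of points of `G × G`
on such a line depends only on the pair `q = (a ^ n, b ^ n)` of non-zero `n`-th powers. Running
over `ρ`, the pair `q` of the line is a fixed multiple `c q'` of a pair `q'` which itself occurs
`M(q')` times (`sum_comp_ratioCount`). Hence the error term is, up to `O(n ^ 2)`,

  `V = ∑ q, M(q) (M(c q) - n ^ 2 / p) ^ 2`

(`abs_shiftedEnergy_sub_le`). Two facts about `M` control this.

* The variance `∑ q, (M(q) - n ^ 2 / p) ^ 2` is at most `p` (`sum_fermatCount_sub_sq_le`), by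
  counting pairs of points directly. A single term then gives `M ≤ n ^ 2 / p + √p`, so that `V ≤ n
  ^ 2 + p ^ (3 / 2)`, which settles large `n`; no bound for character sums is needed.
* Stepanov's method (`mul_card_le_of_stepanov`) shows that `≪ n ^ 2 / A ^ 3` pairs have `M` of
  order at least `A` (`card_filter_fermatCount_le`), whence the sum of `M ^ 3` over the pairs with
  large `M` is `≪ n ^ 2 log n` (`sum_fermatCount_pow_three_le`).

For smaller `n`, the weights `M(q)` up to a threshold `Δ` contribute at most `Δ p` to `V`, and the
others are covered by the third moment. The threshold is `Δ ≍ n ^ 3 p ^ (-3 / 2)` in the middle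
range and `Δ ≍ n ^ 2 log p / p` for `√p ≤ n < √p log p`; for `n < √p` a constant threshold
suffices, as the lines with few points contribute `O(n ^ 2)` to the energy itself. The asymptotic
formula follows by comparing each of the three bounds with `n ^ 4 / p`.
-/

/-! ### Vanishing of polynomials over `𝔽_p` to high order -/

open Polynomial in
/-- A polynomial of degree less than `p` with at most `k` terms cannot vanish to order `k` at a
non-zero point. Induction on `k`: if `e` is an exponent of `f`, then `X f' - e f` has one term fewer
and vanishes to order one less; the bound on the degree keeps the other exponents distinct from `e`
modulo `p`. -/
theorem eq_zero_of_X_sub_C_pow_dvd_of_card_support_le {p : ℕ} [Fact p.Prime] {r : ZMod p}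
    (hr : r ≠ 0) (k : ℕ) (f : (ZMod p)[X]) (hdeg : f.natDegree < p) (hk : f.support.card ≤ k)
    (hdvd : (X - C r) ^ k ∣ f) : f = 0 := by
  induction k generalizing f with
  | zero => simpa using hk
  | succ k ih =>
    by_contra hf
    obtain ⟨e, he⟩ := Polynomial.nonempty_support_iff.2 hf
    set g : (ZMod p)[X] := X * derivative f - C (e : ZMod p) * f with hg
    have hcoeff : ∀ i, g.coeff i = ((i : ZMod p) - e) * f.coeff i := by
      intro i
      rcases i with _ | i
      · simp [hg]
      · simp [hg, coeff_X_mul, coeff_derivative]; ring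
    have hsupp : g.support ⊆ f.support.erase e := by
      intro i hi
      rw [mem_support_iff, hcoeff] at hi
      rw [Finset.mem_erase, mem_support_iff]
      exact ⟨fun h => hi (by simp [h]), right_ne_zero_of_mul hi⟩
    have hg0 : g = 0 := by
      apply ih
      · refine lt_of_le_of_lt (natDegree_le_iff_coeff_eq_zero.2 fun N hN => ?_) hdeg
        rw [hcoeff, coeff_eq_zero_of_natDegree_lt hN, mul_zero]
      · have := Finset.card_le_card hsupp
        rw [Finset.card_erase_of_mem he] at this
        omega
      · obtain ⟨h, hh⟩ := hdvd
        refine ⟨X * (C ((k : ZMod p) + 1) * h + (X - C r) * derivative h)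
          - C (e : ZMod p) * ((X - C r) * h), ?_⟩
        have hd : derivative ((X - C r) ^ (k + 1)) = C ((k : ZMod p) + 1) * (X - C r) ^ k := by
          rw [derivative_X_sub_C_pow]; simp
        rw [hg, hh, derivative_mul, hd]
        ring
    -- `X f' = e f` leaves only the exponent `e`, and a monomial does not vanish at `r`
    have hmono : f = monomial e (f.coeff e) := by
      ext i
      rw [coeff_monomial]
      split_ifs with h
      · rw [h]
      · have h0 := hcoeff i
        rw [hg0, coeff_zero, eq_comm, mul_eq_zero] at h0
        by_contra hi
        have hi' : i ≤ f.natDegree := le_natDegree_of_ne_zero hi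
        have hee : e ≤ f.natDegree := le_natDegree_of_mem_supp _ he
        have h1 := h0.resolve_right hi
        rw [sub_eq_zero, ZMod.natCast_eq_natCast_iff] at h1
        exact h (Nat.ModEq.eq_of_lt_of_lt h1 (by omega) (by omega)).symm
    have hroot : f.eval r = 0 := by
      have : (X - C r) ∣ f := (dvd_pow_self _ (Nat.succ_ne_zero k)).trans hdvd
      exact dvd_iff_isRoot.1 this
    rw [hmono, eval_monomial, mul_eq_zero] at hroot
    exact hroot.elim (mem_support_iff.1 he) (pow_ne_zero _ hr)

open Polynomial in
/-- The derivation `X (1 - X) d/dX`. Unlike `d/dX`, it multiplies `X ^ u * (1 - X) ^ v` by a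
polynomial. -/
noncomputable def eulerDeriv (R : Type*) [CommRing R] : R[X] →ₗ[R] R[X] :=
  LinearMap.mulLeft R (X * (1 - X)) ∘ₗ derivative

open Polynomial in
/-- Away from `0` and `1`, the derivation `X (1 - X) d/dX` detects the order of vanishing, as long
as that order is at most `p`. -/
theorem X_sub_C_pow_dvd_of_eval_eulerDeriv_iterate {p : ℕ} [Fact p.Prime] {x : ZMod p}
    (hx0 : x ≠ 0) (hx1 : x ≠ 1) (D : ℕ) (hD : D ≤ p) (f : (ZMod p)[X])
    (h : ∀ k < D, (((eulerDeriv (ZMod p))^[k]) f).eval x = 0) : (X - C x) ^ D ∣ f := by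
  induction D generalizing f with
  | zero => simp
  | succ D ih =>
    rcases Nat.eq_zero_or_pos D with rfl | hDpos
    · simpa [dvd_iff_isRoot] using h 0 (by simp)
    obtain ⟨g, hg⟩ := ih (by omega) f fun k hk => h k (by omega)
    obtain ⟨g', hg'⟩ := ih (by omega) (eulerDeriv _ f) fun k hk => by
      rw [← Function.iterate_succ_apply]; exact h (k + 1) (by omega)
    obtain ⟨E, rfl⟩ : ∃ E, D = E + 1 := ⟨D - 1, by omega⟩
    have h1 : (X - C x) ^ E * (C ((E : ZMod p) + 1) * (X * (1 - X)) * g)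
        = (X - C x) ^ E * ((X - C x) * (g' - X * (1 - X) * derivative g)) := by
      have : eulerDeriv (ZMod p) f = X * (1 - X) * derivative f := rfl
      have hd : derivative ((X - C x) ^ (E + 1)) = C ((E : ZMod p) + 1) * (X - C x) ^ E := by
        rw [derivative_X_sub_C_pow]; simp
      rw [this, hg, derivative_mul, hd] at hg'
      linear_combination hg'
    have h2 := mul_left_cancel₀ (pow_ne_zero E (X_sub_C_ne_zero x)) h1
    have h3 := congrArg (eval x) h2
    simp only [eval_mul, eval_sub, eval_X, eval_C, sub_self, zero_mul, eval_one, mul_eq_zero] at h3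
    have hE : ((E : ZMod p) + 1) ≠ 0 := by
      have : ((E + 1 : ℕ) : ZMod p) ≠ 0 := by
        rw [Ne, ZMod.natCast_eq_zero_iff]
        exact Nat.not_dvd_of_pos_of_lt (by omega) (by omega)
      simpa using this
    have hgx : g.eval x = 0 := by
      rcases h3 with (h3 | h3 | h3) | h3
      · exact absurd h3 hE
      · exact absurd h3 hx0
      · exact absurd (sub_eq_zero.1 h3).symm hx1
      · exact h3
    obtain ⟨g2, hg2⟩ := dvd_iff_isRoot.2 hgx
    exact ⟨g2, by rw [hg, hg2]; ring⟩

/-! ### Stepanov's method -/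

open Polynomial in
theorem eulerDeriv_apply {R : Type*} [CommRing R] (f : R[X]) :
    eulerDeriv R f = X * (1 - X) * derivative f := rfl

open Polynomial in
/-- The conjugate of `eulerDeriv` by multiplication with `X ^ u * (1 - X) ^ v`. -/
noncomputable def twistedEulerDeriv (R : Type*) [CommRing R] (u v : ℕ) : R[X] →ₗ[R] R[X] :=
  eulerDeriv R + LinearMap.mulLeft R (C (u : R) * (1 - X) - C (v : R) * X)

open Polynomial in
theorem eulerDeriv_mul_X_pow_mul {R : Type*} [CommRing R] (u v : ℕ) (f : R[X]) :
    eulerDeriv R (f * (X ^ u * (1 - X) ^ v))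
      = twistedEulerDeriv R u v f * (X ^ u * (1 - X) ^ v) := by
  have hu : X * derivative (X ^ u : R[X]) = C (u : R) * X ^ u := by
    rcases u with _ | u
    · simp
    · rw [derivative_X_pow]; simp [pow_succ]; ring
  have hv : (1 - X) * derivative ((1 - X) ^ v : R[X]) = - C (v : R) * (1 - X) ^ v := by
    rcases v with _ | v
    · simp
    · rw [derivative_pow]; simp [pow_succ]; ring
  simp only [twistedEulerDeriv, eulerDeriv_apply, LinearMap.add_apply, LinearMap.mulLeft_apply,
    derivative_mul]
  linear_combination f * (1 - X) ^ v * (1 - X) * hu + f * X ^ u * X * hv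

open Polynomial in
theorem eulerDeriv_iterate_mul_X_pow_mul {R : Type*} [CommRing R] (u v k : ℕ) (f : R[X]) :
    (eulerDeriv R ^ k) (f * (X ^ u * (1 - X) ^ v))
      = (twistedEulerDeriv R u v ^ k) f * (X ^ u * (1 - X) ^ v) := by
  induction k with
  | zero => simp
  | succ k ih =>
    rw [pow_succ', pow_succ', Module.End.mul_apply, Module.End.mul_apply, ih,
      eulerDeriv_mul_X_pow_mul]

open Polynomial in
/-- Each application of the twisted derivation raises the degree by at most one, whatever the size
of `u` and `v`. This keeps the number of linear conditions in Stepanov's method small. -/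
theorem twistedEulerDeriv_pow_mem_degreeLT {R : Type*} [CommRing R] (u v A k : ℕ) {f : R[X]}
    (hf : f ∈ degreeLT R A) : (twistedEulerDeriv R u v ^ k) f ∈ degreeLT R (A + k) := by
  induction k with
  | zero => simpa using hf
  | succ k ih =>
    rw [pow_succ', Module.End.mul_apply]
    set g := (twistedEulerDeriv R u v ^ k) f
    have hg : ∀ i, A + k ≤ i → g.coeff i = 0 := by
      intro i hi
      exact coeff_eq_zero_of_degree_lt ((mem_degreeLT.1 ih).trans_le (by exact_mod_cast hi))
    rw [mem_degreeLT, degree_lt_iff_coeff_zero]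
    intro i hi
    have e : twistedEulerDeriv R u v g = X * derivative g - X * (X * derivative g)
      + C (u : R) * g - C ((u : R) + v) * (X * g) := by
      simp only [twistedEulerDeriv, eulerDeriv_apply, LinearMap.add_apply,
        LinearMap.mulLeft_apply, map_add]
      ring
    obtain ⟨j, rfl⟩ : ∃ j, i = j + 1 := ⟨i - 1, by omega⟩
    have hXd : ∀ i, A + k ≤ i → (X * derivative g).coeff i = 0 := by
      intro i hi
      rcases i with _ | i
      · simp
      · rw [coeff_X_mul, coeff_derivative, hg _ hi, zero_mul]
    rw [e]
    simp only [coeff_add, coeff_sub, coeff_C_mul]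
    rw [hXd (j + 1) (by omega), coeff_X_mul (X * _), hXd j (by omega), hg (j + 1) (by omega),
      coeff_X_mul g, hg j (by omega)]
    simp

open Polynomial in
/-- For `Q c` of degree less than `A ≤ n`, the blocks of coefficients of the `Q c * X ^ (n * c)` do
not overlap. -/
theorem coeff_sum_mul_X_pow_mul {R : Type*} [CommRing R] {n A : ℕ} (hn : 0 < n) (hAn : A ≤ n)
    (B : ℕ) (Q : ℕ → R[X]) (hQ : ∀ c, Q c ∈ degreeLT R A) (i : ℕ) :
    (∑ c ∈ Finset.range B, Q c * X ^ (n * c)).coeff i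
      = if i / n < B then (Q (i / n)).coeff (i % n) else 0 := by
  have key : ∀ c, (Q c * X ^ (n * c)).coeff i
      = if i / n = c then (Q (i / n)).coeff (i % n) else 0 := by
    intro c
    rw [coeff_mul_X_pow']
    have hdm := Nat.div_add_mod i n
    have hml := Nat.mod_lt i hn
    split_ifs with h1 h2 h2
    · subst h2
      congr 1
      omega
    · apply coeff_eq_zero_of_degree_lt
      refine (mem_degreeLT.1 (hQ c)).trans_le ?_
      have h3 : c < i / n := lt_of_le_of_ne ((Nat.le_div_iff_mul_le hn).2 (by linarith))
        (Ne.symm h2)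
      have h4 : n * (c + 1) ≤ n * (i / n) := Nat.mul_le_mul_left n h3
      rw [mul_add] at h4
      exact_mod_cast (by omega : A ≤ i - n * c)
    · subst h2; omega
    · rfl
  rw [finsetSum_coeff, Finset.sum_congr rfl fun c _ => key c]
  simp

open Polynomial in
/-- The polynomials `X ^ (n b) (1 - X) ^ (n c)` with `b, c < B` are linearly independent over the
polynomials of degree less than `A`, provided that `A B ≤ n` and `n B ≤ p`. In a relation, the
coefficient `∑ c, P b c (1 - X) ^ (n c)` of the lowest occurring `X ^ (n b)` is divisible by `X ^
n`, but as a polynomial in `1 - X` it has at most `A B ≤ n` terms. -/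
theorem forall_eq_zero_of_sum_mul_X_pow_mul_eq_zero {p : ℕ} [Fact p.Prime] {n A B : ℕ}
    (hn : 0 < n) (hAn : A ≤ n) (hAB : A * B ≤ n) (hnB : n * B ≤ p) (P : ℕ → ℕ → (ZMod p)[X])
    (hP : ∀ b c, P b c ∈ degreeLT (ZMod p) A)
    (h : ∑ b ∈ Finset.range B, ∑ c ∈ Finset.range B,
      P b c * (X ^ (n * b) * (1 - X) ^ (n * c)) = 0) :
    ∀ b < B, ∀ c < B, P b c = 0 := by
  intro b
  induction b using Nat.strong_induction_on with
  | _ b ih =>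
  intro hb
  set F : ℕ → (ZMod p)[X] := fun b => ∑ c ∈ Finset.range B, P b c * (1 - X) ^ (n * c) with hF
  have hsum : ∑ b ∈ Finset.range B, F b * X ^ (n * b) = 0 := by
    rw [← h]
    refine Finset.sum_congr rfl fun b _ => ?_
    rw [hF, Finset.sum_mul]
    exact Finset.sum_congr rfl fun c _ => by ring
  have hF0 : ∀ b' < b, F b' = 0 := fun b' hb' =>
    Finset.sum_eq_zero fun c hc => by
      rw [ih b' hb' (by omega) c (Finset.mem_range.1 hc), zero_mul]
  have hdvd : (X : (ZMod p)[X]) ^ n ∣ F b := by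
    have h1 : (X : (ZMod p)[X]) ^ (n * b) * X ^ n ∣ X ^ (n * b) * F b := by
      rw [mul_comm _ (F b)]
      rw [← Finset.add_sum_erase _ _ (Finset.mem_range.2 hb)] at hsum
      rw [eq_neg_of_add_eq_zero_left hsum, dvd_neg]
      refine Finset.dvd_sum fun b' hb' => ?_
      rw [Finset.mem_erase] at hb'
      rcases lt_or_gt_of_ne hb'.1 with hlt | hlt
      · rw [hF0 b' hlt, zero_mul]; exact dvd_zero _
      · refine Dvd.dvd.mul_left ?_ _
        rw [← pow_add]
        exact pow_dvd_pow _ (by nlinarith)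
    exact (mul_dvd_mul_iff_left (pow_ne_zero (n * b) X_ne_zero)).1 h1
  -- pass to the variable `1 - X`, in which the coefficient is sparse
  set Q : ℕ → (ZMod p)[X] := fun c => (P b c).comp (1 - X) with hQdef
  have hQ : ∀ c, Q c ∈ degreeLT (ZMod p) A := by
    intro c
    by_cases hz : P b c = 0
    · simp [hQdef, hz]
    have h1 : (1 - X : (ZMod p)[X]).natDegree ≤ 1 := by
      compute_degree
    have h2 : (Q c).natDegree ≤ (P b c).natDegree * 1 :=
      natDegree_comp_le.trans (Nat.mul_le_mul_left _ h1)
    rw [mem_degreeLT]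
    refine degree_le_natDegree.trans_lt ?_
    have h3 := mem_degreeLT.1 (hP b c)
    rw [degree_eq_natDegree hz] at h3
    exact lt_of_le_of_lt (by exact_mod_cast (by omega : (Q c).natDegree ≤ (P b c).natDegree)) h3
  have hcomp : (F b).comp (1 - X) = ∑ c ∈ Finset.range B, Q c * X ^ (n * c) := by
    rw [hF, Polynomial.sum_comp]
    refine Finset.sum_congr rfl fun c _ => ?_
    simp [hQdef]
  have hco := coeff_sum_mul_X_pow_mul hn hAn B Q hQ
  rw [← hcomp] at hco
  have hdvd' : (X - C (1 : ZMod p)) ^ n ∣ (F b).comp (1 - X) := by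
    obtain ⟨g, hg⟩ := hdvd
    rw [hg, mul_comp, pow_comp, X_comp, show (1 - X : (ZMod p)[X]) = -(X - C 1) by simp, neg_pow]
    exact (Dvd.intro_left _ rfl).trans (Dvd.intro _ rfl)
  have hsupp : ((F b).comp (1 - X)).support ⊆
      (Finset.range A ×ˢ Finset.range B).image fun q => q.1 + n * q.2 := by
    intro i hi
    rw [mem_support_iff, hco] at hi
    have hiB : i / n < B := by
      by_contra hcon
      simp [hcon] at hi
    rw [if_pos hiB] at hi
    refine Finset.mem_image.2 ⟨(i % n, i / n), ?_, Nat.mod_add_div i n⟩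
    rw [Finset.mem_product, Finset.mem_range, Finset.mem_range]
    refine ⟨?_, hiB⟩
    by_contra hcon
    exact hi (coeff_eq_zero_of_degree_lt ((mem_degreeLT.1 (hQ _)).trans_le
      (by exact_mod_cast not_lt.1 hcon)))
  have hzero : (F b).comp (1 - X) = 0 := by
    refine eq_zero_of_X_sub_C_pow_dvd_of_card_support_le one_ne_zero n _ ?_ ?_ hdvd'
    · refine lt_of_lt_of_le ?_ hnB
      by_contra hcon
      rw [not_lt] at hcon
      have hne : (F b).comp (1 - X) ≠ 0 := by
        intro h0
        rw [h0, natDegree_zero] at hcon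
        have := Nat.mul_pos hn (by omega : 0 < B)
        omega
      have hmem := natDegree_mem_support_of_nonzero hne
      obtain ⟨q, hq, he⟩ := Finset.mem_image.1 (hsupp hmem)
      rw [Finset.mem_product, Finset.mem_range, Finset.mem_range] at hq
      have h5 : n * (q.2 + 1) ≤ n * B := Nat.mul_le_mul_left n hq.2
      rw [mul_add] at h5
      omega
    · refine (Finset.card_le_card hsupp).trans (Finset.card_image_le.trans ?_)
      simpa using hAB
  intro c hc
  have hQc : Q c = 0 := by
    ext a
    by_cases ha : a < A
    · have h6 := hco (a + n * c)
      rw [hzero, Nat.add_mul_div_left _ _ hn, Nat.div_eq_of_lt (by omega), zero_add, if_pos hc,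
        Nat.add_mul_mod_self_left, Nat.mod_eq_of_lt (by omega)] at h6
      exact h6.symm
    · exact coeff_eq_zero_of_degree_lt ((mem_degreeLT.1 (hQ _)).trans_le
        (by exact_mod_cast not_lt.1 ha))
  have h7 : (Q c).comp (1 - X) = P b c := by
    simp [hQdef, comp_assoc]
  rw [← h7, hQc, zero_comp]

open Polynomial in
/-- Stepanov's bound for the number of `z` such that `(z ^ n, (1 - z) ^ n)` lies in a given set
`I` of pairs. A non-zero polynomial `∑ P b c X ^ (n b) (1 - X) ^ (n c)` with `b, c < B` and `deg P
b c < A` is made to vanish to order `A` at all these `z`. For a pair in `I` the `k`-th condition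
is the vanishing of a polynomial of degree less than `2 A` depending only on the pair, as `z ^ n`
and `(1 - z) ^ n` are constant; so there are `2 A ^ 2 |I|` conditions on `A B ^ 2` coefficients.
-/
theorem mul_card_le_of_stepanov {p : ℕ} [Fact p.Prime] {n A B : ℕ}
    (hA : 0 < A) (hAB : A * B ≤ n) (hnB : n * B ≤ p) (hnp : n ≤ p)
    (I : Finset (ZMod p × ZMod p)) (hI : ∀ q ∈ I, q.1 ≠ 0 ∧ q.2 ≠ 0)
    (hIB : 2 * I.card * A < B ^ 2) :
    A * (Finset.univ.filter fun z : ZMod p => (z ^ n, (1 - z) ^ n) ∈ I).card ≤ A + 2 * n * B := by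
  have hB : 0 < B := by
    rcases Nat.eq_zero_or_pos B with rfl | h
    · simp at hIB
    · exact h
  have hAn : A ≤ n := le_trans (Nat.le_mul_of_pos_right A hB) hAB
  have hn : 0 < n := by omega
  -- the component `(q, k, j)` is the `j`-th coefficient of the `k`-th derivative, after
  -- substituting `q` for `(z ^ n, (1 - z) ^ n)`
  let Φ : (Fin B × Fin B → degreeLT (ZMod p) A) →ₗ[ZMod p] (I × Fin A × Fin (A + A) → ZMod p) :=
    LinearMap.pi fun j => ∑ r : Fin B × Fin B,
    (j.1.1.1 ^ (r.1 : ℕ) * j.1.1.2 ^ (r.2 : ℕ)) •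
      (lcoeff (ZMod p) (j.2.2 : ℕ) ∘ₗ
        (twistedEulerDeriv (ZMod p) (n * r.1) (n * r.2) ^ (j.2.1 : ℕ)) ∘ₗ
          (degreeLT (ZMod p) A).subtype ∘ₗ LinearMap.proj r)
  have hfin : Module.finrank (ZMod p) (degreeLT (ZMod p) A) = A := by
    rw [(degreeLTEquiv (ZMod p) A).finrank_eq]; simp
  have : FiniteDimensional (ZMod p) (degreeLT (ZMod p) A) :=
    (degreeLTEquiv (ZMod p) A).symm.finiteDimensional
  have hdim : Module.finrank (ZMod p) (I × Fin A × Fin (A + A) → ZMod p)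
      < Module.finrank (ZMod p) (Fin B × Fin B → degreeLT (ZMod p) A) := by
    have h1 : Module.finrank (ZMod p) (Fin B × Fin B → degreeLT (ZMod p) A) = B * B * A := by
      simp only [Module.finrank_pi_fintype, hfin]
      simp
    have h2 : Module.finrank (ZMod p) (I × Fin A × Fin (A + A) → ZMod p)
        = I.card * (A * (A + A)) := by simp
    rw [h1, h2]
    nlinarith
  obtain ⟨v, hv, hv0⟩ := Submodule.exists_mem_ne_zero_of_ne_bot
    (LinearMap.ker_ne_bot_of_finrank_lt (f := Φ) hdim)
  rw [LinearMap.mem_ker] at hv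
  set Ψ : (ZMod p)[X] := ∑ r : Fin B × Fin B,
    (v r : (ZMod p)[X]) * (X ^ (n * (r.1 : ℕ)) * (1 - X) ^ (n * (r.2 : ℕ))) with hΨ
  have hΨ0 : Ψ ≠ 0 := by
    intro h0
    set P : ℕ → ℕ → (ZMod p)[X] := fun b c =>
      if h : b < B ∧ c < B then (v (⟨b, h.1⟩, ⟨c, h.2⟩) : (ZMod p)[X]) else 0 with hP
    have hPv : ∀ b c : Fin B, P b c = v (b, c) := fun b c => by simp [hP]
    have hPd : ∀ b c, P b c ∈ degreeLT (ZMod p) A := by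
      intro b c
      by_cases h : b < B ∧ c < B
      · simp only [hP, dif_pos h]; exact Submodule.coe_mem _
      · simp only [hP, dif_neg h]; exact Submodule.zero_mem _
    have hsum : ∑ b ∈ Finset.range B, ∑ c ∈ Finset.range B,
        P b c * (X ^ (n * b) * (1 - X) ^ (n * c)) = 0 := by
      rw [← h0, hΨ, Fintype.sum_prod_type, Finset.sum_range]
      refine Finset.sum_congr rfl fun b _ => ?_
      rw [Finset.sum_range]
      exact Finset.sum_congr rfl fun c _ => by rw [hPv]
    have hall := forall_eq_zero_of_sum_mul_X_pow_mul_eq_zero hn hAn hAB hnB P hPd hsum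
    apply hv0
    funext r
    apply Subtype.ext
    rw [← hPv r.1 r.2, hall r.1 r.1.2 r.2 r.2.2]
    rfl
  have hdeg : Ψ.natDegree ≤ A + 2 * n * B := by
    refine natDegree_sum_le_of_forall_le _ _ fun r _ => ?_
    have h1 : (v r : (ZMod p)[X]).natDegree ≤ A := by
      rw [natDegree_le_iff_degree_le]
      exact (mem_degreeLT.1 (v r).2).le
    have h2 : ((X : (ZMod p)[X]) ^ (n * (r.1 : ℕ))).natDegree ≤ n * B := by
      rw [natDegree_X_pow]
      exact Nat.mul_le_mul_left _ r.1.2.le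
    have h3 : ((1 - X : (ZMod p)[X]) ^ (n * (r.2 : ℕ))).natDegree ≤ n * B := by
      have h4 : (1 - X : (ZMod p)[X]).natDegree ≤ 1 := by compute_degree
      refine natDegree_pow_le.trans ?_
      calc n * (r.2 : ℕ) * (1 - X : (ZMod p)[X]).natDegree ≤ n * B * 1 :=
            Nat.mul_le_mul (Nat.mul_le_mul_left _ r.2.2.le) h4
        _ = n * B := mul_one _
    have h5 := natDegree_mul_le (p := (v r : (ZMod p)[X]))
      (q := X ^ (n * (r.1 : ℕ)) * (1 - X) ^ (n * (r.2 : ℕ)))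
    have h6 := natDegree_mul_le (p := (X : (ZMod p)[X]) ^ (n * (r.1 : ℕ)))
      (q := (1 - X) ^ (n * (r.2 : ℕ)))
    have h7 : A + 2 * n * B = A + (n * B + n * B) := by ring
    omega
  have hdvd : ∀ x ∈ (Finset.univ.filter fun z : ZMod p => (z ^ n, (1 - z) ^ n) ∈ I),
      (X - C x) ^ A ∣ Ψ := by
    intro x hx
    have hxI := (Finset.mem_filter.1 hx).2
    obtain ⟨hx0, hx1⟩ := hI _ hxI
    refine X_sub_C_pow_dvd_of_eval_eulerDeriv_iterate (fun h => hx0 ?_) (fun h => hx1 ?_) A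
      (hAn.trans hnp) Ψ fun k hk => ?_
    · simp [h, hn.ne']
    · simp [h, hn.ne']
    have hpoly : ∑ r : Fin B × Fin B, C ((x ^ n) ^ (r.1 : ℕ) * ((1 - x) ^ n) ^ (r.2 : ℕ)) *
        (twistedEulerDeriv (ZMod p) (n * r.1) (n * r.2) ^ k) (v r : (ZMod p)[X]) = 0 := by
      ext i
      by_cases hi : i < A + A
      · have h1 := congrFun hv (⟨_, hxI⟩, ⟨k, hk⟩, ⟨i, hi⟩)
        simp only [Φ, LinearMap.pi_apply, LinearMap.sum_apply, LinearMap.smul_apply,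
          LinearMap.comp_apply, LinearMap.proj_apply, Submodule.subtype_apply, lcoeff_apply,
          smul_eq_mul, Pi.zero_apply] at h1
        rw [finsetSum_coeff, coeff_zero, ← h1]
        exact Finset.sum_congr rfl fun r _ => by rw [coeff_C_mul]
      · rw [finsetSum_coeff, coeff_zero]
        refine Finset.sum_eq_zero fun r _ => ?_
        rw [coeff_C_mul, coeff_eq_zero_of_degree_lt, mul_zero]
        exact (mem_degreeLT.1 (twistedEulerDeriv_pow_mem_degreeLT _ _ A k (v r).2)).trans_le
          (by exact_mod_cast (by omega : A + k ≤ i))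
    have h2 := congrArg (eval x) hpoly
    rw [eval_finsetSum, eval_zero] at h2
    rw [← Module.End.pow_apply, hΨ, map_sum, eval_finsetSum, ← h2]
    refine Finset.sum_congr rfl fun r _ => ?_
    rw [eulerDeriv_iterate_mul_X_pow_mul]
    simp only [eval_mul, eval_pow, eval_sub, eval_one, eval_X, eval_C, pow_mul]
    ring
  have hprod := Finset.prod_dvd_of_coprime (fun a _ b _ hab =>
    ((pairwise_coprime_X_sub_C (s := fun x : ZMod p => x) Function.injective_id hab).pow
      (m := A) (n := A))) hdvd
  have hle := natDegree_le_of_dvd hprod hΨ0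
  rw [natDegree_prod_of_monic _ _ fun x _ => (monic_X_sub_C x).pow A] at hle
  simp only [natDegree_pow, natDegree_X_sub_C, Finset.sum_const, smul_eq_mul, mul_one] at hle
  rw [mul_comm]
  exact hle.trans hdeg

/-! ### Pairs of powers with many solutions -/

/-- The number of `z ∈ 𝔽_p` with `z ^ n = q.1` and `(1 - z) ^ n = q.2`. When `𝔽_p` contains `n`
roots of unity of order dividing `n`, forming a group `G`, and `q = (a ^ n, b ^ n)` with `a, b ≠ 0`,
this is the number of points of `G × G` on the line `a x + b y = 1`. -/
noncomputable def fermatCount {p : ℕ} [Fact p.Prime] (n : ℕ) (q : ZMod p × ZMod p) : ℕ :=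
  (Finset.univ.filter fun z : ZMod p => (z ^ n, (1 - z) ^ n) = q).card

theorem card_filter_mem_eq_sum_fermatCount {p : ℕ} [Fact p.Prime] (n : ℕ)
    (I : Finset (ZMod p × ZMod p)) :
    (Finset.univ.filter fun z : ZMod p => (z ^ n, (1 - z) ^ n) ∈ I).card
      = ∑ q ∈ I, fermatCount n q := by
  rw [Finset.card_eq_sum_card_fiberwise (f := fun z : ZMod p => (z ^ n, (1 - z) ^ n)) (t := I)
    (fun z hz => by simpa using hz)]
  refine Finset.sum_congr rfl fun q hq => ?_
  rw [fermatCount, Finset.filter_filter]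
  congr 1
  ext z
  simp only [Finset.mem_filter, Finset.mem_univ, true_and]
  exact ⟨fun h => h.2, fun h => ⟨h ▸ hq, h⟩⟩

theorem fermatCount_le {p : ℕ} [Fact p.Prime] {n : ℕ} (hn : 0 < n) (q : ZMod p × ZMod p) :
    fermatCount n q ≤ n := by
  refine le_trans (Finset.card_le_card ?_) (Polynomial.card_nthRoots n q.1 |> le_trans
    (Multiset.toFinset_card_le _))
  intro z hz
  simp only [Finset.mem_filter, Finset.mem_univ, true_and] at hz
  rw [Multiset.mem_toFinset, Polynomial.mem_nthRoots hn, ← hz]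

/-- Stepanov's bound with the choice `B = n / A`. -/
theorem sq_mul_sum_fermatCount_le {p : ℕ} [Fact p.Prime] {n A : ℕ} (hA : 0 < A) (hnp : n ≤ p)
    (hpA : n ^ 2 ≤ p * A) (I : Finset (ZMod p × ZMod p)) (hI : ∀ q ∈ I, q.1 ≠ 0 ∧ q.2 ≠ 0)
    (hcard : 8 * I.card * A ^ 3 < n ^ 2) :
    A ^ 2 * ∑ q ∈ I, fermatCount n q ≤ 3 * n ^ 2 := by
  rcases Finset.eq_empty_or_nonempty I with rfl | hne
  · simp
  have hK : 1 ≤ I.card := hne.card_pos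
  have hAn : A ≤ n := by
    by_contra h
    have h1 : n ^ 2 ≤ A ^ 2 := Nat.pow_le_pow_left (by omega) 2
    have h2 : A ^ 2 ≤ A ^ 3 := Nat.pow_le_pow_right hA (by norm_num)
    nlinarith
  set B := n / A with hB
  have hB1 : 1 ≤ B := (Nat.one_le_div_iff hA).2 hAn
  have hAB : A * B ≤ n := Nat.mul_div_le n A
  have hn2 : n < 2 * (A * B) := by
    have h1 : n < A * (B + 1) := Nat.lt_mul_div_succ n hA
    have h2 : A ≤ A * B := Nat.le_mul_of_pos_right A hB1
    linarith
  have hIB : 2 * I.card * A < B ^ 2 := by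
    have h1 : n ^ 2 < (2 * (A * B)) ^ 2 := Nat.pow_lt_pow_left hn2 two_ne_zero
    have h2 : 4 * A ^ 2 * (2 * I.card * A) < 4 * A ^ 2 * B ^ 2 := by nlinarith
    exact lt_of_mul_lt_mul_left h2 (Nat.zero_le _)
  have hnB : n * B ≤ p := by
    have h1 : n * (A * B) ≤ n * n := Nat.mul_le_mul_left n hAB
    have h2 : A * (n * B) ≤ A * p := by nlinarith
    exact le_of_mul_le_mul_left h2 hA
  have hmain := mul_card_le_of_stepanov hA hAB hnB hnp I hI hIB
  rw [card_filter_mem_eq_sum_fermatCount] at hmain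
  have h1 : A * (A * ∑ q ∈ I, fermatCount n q) ≤ A * (A + 2 * n * B) :=
    Nat.mul_le_mul_left A hmain
  have h2 : n * (A * B) ≤ n * n := Nat.mul_le_mul_left n hAB
  have h3 : A * A ≤ n * n := Nat.mul_le_mul hAn hAn
  nlinarith

/-- At most `n ^ 2 / (8 A ^ 3)` of the pairs have `fermatCount` above `192 A`. -/
theorem card_filter_fermatCount_le {p : ℕ} [Fact p.Prime] {n A : ℕ} (hn : 0 < n) (hA : 0 < A)
    (hnp : n ≤ p) (hpA : n ^ 2 ≤ p * A) (hn3 : 512 * n ^ 3 ≤ p ^ 2)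
    (I : Finset (ZMod p × ZMod p)) (hI : ∀ q ∈ I, q.1 ≠ 0 ∧ q.2 ≠ 0) :
    8 * (I.filter fun q => 192 * A < fermatCount n q).card * A ^ 3 ≤ n ^ 2 := by
  set J := I.filter fun q => 192 * A < fermatCount n q with hJ
  have hJI : ∀ q ∈ J, q.1 ≠ 0 ∧ q.2 ≠ 0 := fun q hq => hI q (Finset.mem_filter.1 hq).1
  have hJM : ∀ q ∈ J, 192 * A < fermatCount n q := fun q hq => (Finset.mem_filter.1 hq).2
  by_contra! hcon
  have hA3 : 0 < A ^ 3 := pow_pos hA 3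
  rcases lt_or_ge (8 * A ^ 3) (n ^ 2) with hlt | hge
  -- `K` is the largest number of pairs to which Stepanov's bound with parameter `A` applies
  · set K := (n ^ 2 - 1) / (8 * A ^ 3) with hK
    have h8 : 0 < 8 * A ^ 3 := by omega
    have hK1 : 1 ≤ K := (Nat.one_le_div_iff h8).2 (by omega)
    have hKle : 8 * A ^ 3 * K ≤ n ^ 2 - 1 := Nat.mul_div_le _ _
    have hKlt : n ^ 2 - 1 < 8 * A ^ 3 * (K + 1) := Nat.lt_mul_div_succ _ h8
    have hn2 : 0 < n ^ 2 := pow_pos hn 2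
    have hKJ : K ≤ J.card := by
      by_contra! h
      have : 8 * A ^ 3 * J.card ≤ 8 * A ^ 3 * K := Nat.mul_le_mul_left _ h.le
      have h' : 8 * J.card * A ^ 3 = 8 * A ^ 3 * J.card := by ring
      omega
    obtain ⟨J', hJ'J, hJ'c⟩ := Finset.exists_subset_card_eq hKJ
    have h1 := sq_mul_sum_fermatCount_le hA hnp hpA J' (fun q hq => hJI q (hJ'J hq)) (by
      rw [hJ'c]
      have : 8 * K * A ^ 3 = 8 * A ^ 3 * K := by ring
      omega)
    have h2 : K * (192 * A) ≤ ∑ q ∈ J', fermatCount n q := by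
      rw [← hJ'c, ← smul_eq_mul]
      exact Finset.card_nsmul_le_sum _ _ _ fun q hq => (hJM q (hJ'J hq)).le
    have h3 : A ^ 2 * (K * (192 * A)) ≤ A ^ 2 * ∑ q ∈ J', fermatCount n q :=
      Nat.mul_le_mul_left _ h2
    have h4 : A ^ 3 * 1 ≤ A ^ 3 * K := Nat.mul_le_mul_left _ hK1
    have h5 : A ^ 2 * (K * (192 * A)) = 192 * (A ^ 3 * K) := by ring
    have h6 : 8 * A ^ 3 * (K + 1) = 8 * (A ^ 3 * K) + 8 * A ^ 3 := by ring
    omega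
  -- `A` is too large even for one pair: replace it by the largest `k` with `8 k ^ 3 < n ^ 2`
  · have hJne : J.Nonempty := by
      rw [Finset.nonempty_iff_ne_empty]
      rintro h
      simp [h] at hcon
    obtain ⟨q, hq⟩ := hJne
    have hqM := hJM q hq
    have hqn := fermatCount_le hn q
    have hn192 : 192 < n := by omega
    have hex : ∃ k, n ^ 2 ≤ 8 * (k + 1) ^ 3 := ⟨A, hge.trans (by gcongr; omega)⟩
    set k := Nat.find hex with hk
    have hk2 : n ^ 2 ≤ 8 * (k + 1) ^ 3 := Nat.find_spec hex
    have hk1 : 1 ≤ k := by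
      by_contra! h
      have : k = 0 := by omega
      rw [this] at hk2
      nlinarith
    have hk3 : 8 * k ^ 3 < n ^ 2 := by
      have := Nat.find_min hex (m := k - 1) (by omega)
      rw [Nat.sub_add_cancel hk1] at this
      omega
    have hkA : k < A := by
      by_contra! h
      have : A ^ 3 ≤ k ^ 3 := Nat.pow_le_pow_left h 3
      omega
    have hk4 : n ^ 2 ≤ 64 * k ^ 3 := by
      have : (k + 1) ^ 3 ≤ (2 * k) ^ 3 := Nat.pow_le_pow_left (by omega) 3
      rw [mul_pow] at this
      omega
    have hnp4 : 64 * n ^ 4 ≤ p ^ 3 := by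
      have hp : 1 ≤ p := by omega
      refine le_of_pow_le_pow_left₀ (n := 3) (by norm_num) (Nat.zero_le _) ?_
      calc (64 * n ^ 4) ^ 3 ≤ (512 * n ^ 3) ^ 4 := by
            rw [mul_pow, mul_pow, ← pow_mul, ← pow_mul]; gcongr <;> norm_num
        _ ≤ (p ^ 2) ^ 4 := Nat.pow_le_pow_left hn3 4
        _ ≤ (p ^ 3) ^ 3 := by
            rw [← pow_mul, ← pow_mul]; exact Nat.pow_le_pow_right hp (by norm_num)
    have hpk : n ^ 2 ≤ p * k := by
      refine le_of_pow_le_pow_left₀ (n := 3) (by norm_num) (Nat.zero_le _) ?_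
      refine le_of_mul_le_mul_left (a := 64) ?_ (by norm_num)
      calc 64 * (n ^ 2) ^ 3 = (64 * n ^ 4) * n ^ 2 := by ring
        _ ≤ p ^ 3 * (64 * k ^ 3) := Nat.mul_le_mul hnp4 hk4
        _ = 64 * (p * k) ^ 3 := by ring
    have h1 := sq_mul_sum_fermatCount_le hk1 hnp hpk {q} (by simpa using hJI q hq)
      (by simpa using hk3)
    rw [Finset.sum_singleton] at h1
    have h2 : k ^ 2 * fermatCount n q ≤ k ^ 2 * (192 * k) := by
      calc _ ≤ 3 * n ^ 2 := h1
        _ ≤ 3 * (64 * k ^ 3) := Nat.mul_le_mul_left _ hk4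
        _ = _ := by ring
    have h3 := le_of_mul_le_mul_left h2 (by positivity)
    omega

theorem pow_three_sub_pow_three_le_sum_Ioc {a b : ℕ} (hab : a ≤ b) :
    (b : ℝ) ^ 3 - (a : ℝ) ^ 3 ≤ ∑ k ∈ Finset.Ioc a b, 3 * (k : ℝ) ^ 2 := by
  induction b, hab using Nat.le_induction with
  | base => simp
  | succ b hb ih =>
    rw [Finset.sum_Ioc_succ_top (by omega)]
    push_cast
    have : (0 : ℝ) ≤ b := Nat.cast_nonneg b
    nlinarith

/-- Third moment over the pairs with many solutions, by summation over the levels `192 k`: the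
level `k` contributes `k ^ 2 * (n ^ 2 / k ^ 3)`, which is where the logarithm comes from. -/
theorem sum_fermatCount_pow_three_le {p : ℕ} [Fact p.Prime] {n A : ℕ} (hn : 0 < n) (hA : 0 < A)
    (hnp : n ≤ p) (hpA : n ^ 2 ≤ p * A) (hn3 : 512 * n ^ 3 ≤ p ^ 2)
    (I : Finset (ZMod p × ZMod p)) (hI : ∀ q ∈ I, q.1 ≠ 0 ∧ q.2 ≠ 0) :
    ∑ q ∈ I with 192 * A < fermatCount n q, (fermatCount n q : ℝ) ^ 3
      ≤ 384 ^ 3 * ((n : ℝ) ^ 2 * (1 + Real.log n)) := by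
  have hcount : ∀ k, A ≤ k →
      8 * (k : ℝ) ^ 3 * ((I.filter fun q => 192 * k < fermatCount n q).card : ℝ) ≤ (n : ℝ) ^ 2 := by
    intro k hk
    have := card_filter_fermatCount_le hn (by omega) hnp (hpA.trans (Nat.mul_le_mul_left p hk))
      hn3 I hI (A := k)
    have h : ((8 * (I.filter fun q => 192 * k < fermatCount n q).card * k ^ 3 : ℕ) : ℝ)
      ≤ ((n ^ 2 : ℕ) : ℝ) := by exact_mod_cast this
    push_cast at h
    linarith
  have hpt : ∀ q ∈ I.filter (fun q => 192 * A < fermatCount n q), (fermatCount n q : ℝ) ^ 3 ≤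
      384 ^ 3 * ((A : ℝ) ^ 3 + ∑ k ∈ Finset.Ioc A n,
        if 192 * k < fermatCount n q then 3 * (k : ℝ) ^ 2 else 0) := by
    intro q hq
    have hqM := (Finset.mem_filter.1 hq).2
    have hqn := fermatCount_le hn q
    set M := fermatCount n q
    -- the largest `a` with `192 * a < M`
    set a := (M - 1) / 192 with ha
    have haA : A ≤ a := by omega
    have h1 := pow_three_sub_pow_three_le_sum_Ioc haA
    have h2 : ∑ k ∈ Finset.Ioc A a, 3 * (k : ℝ) ^ 2 ≤ ∑ k ∈ Finset.Ioc A n,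
        if 192 * k < M then 3 * (k : ℝ) ^ 2 else 0 := by
      rw [← Finset.sum_filter]
      refine Finset.sum_le_sum_of_subset_of_nonneg ?_ fun _ _ _ => by positivity
      intro k hk
      rw [Finset.mem_Ioc] at hk
      rw [Finset.mem_filter, Finset.mem_Ioc]
      omega
    have h3 : (M : ℝ) ≤ 384 * a := by
      exact_mod_cast (by omega : M ≤ 384 * a)
    calc (M : ℝ) ^ 3 ≤ (384 * a) ^ 3 := by gcongr
      _ = 384 ^ 3 * (a : ℝ) ^ 3 := by ring
      _ ≤ _ := by gcongr; linarith
  refine (Finset.sum_le_sum hpt).trans ?_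
  rw [← Finset.mul_sum]
  refine mul_le_mul_of_nonneg_left ?_ (by norm_num)
  rw [Finset.sum_add_distrib, Finset.sum_const, nsmul_eq_mul, Finset.sum_comm]
  have hk : ∀ k ∈ Finset.Ioc A n, (∑ q ∈ I with 192 * A < fermatCount n q,
      if 192 * k < fermatCount n q then 3 * (k : ℝ) ^ 2 else 0)
      ≤ 3 / 8 * (n : ℝ) ^ 2 * (k : ℝ)⁻¹ := by
    intro k hk
    rw [Finset.mem_Ioc] at hk
    rw [← Finset.sum_filter, Finset.sum_const, nsmul_eq_mul, Finset.filter_filter]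
    have h1 : (I.filter fun q => 192 * A < fermatCount n q ∧ 192 * k < fermatCount n q)
        = I.filter fun q => 192 * k < fermatCount n q := by
      apply Finset.filter_congr
      intro q _
      exact ⟨fun h => h.2, fun h => ⟨by omega, h⟩⟩
    rw [h1]
    have h2 := hcount k hk.1.le
    have hk0 : (0 : ℝ) < k := by exact_mod_cast (by omega : 0 < k)
    rw [← div_eq_mul_inv, le_div_iff₀ hk0]
    linarith
  have h1 := Finset.sum_le_sum hk
  rw [← Finset.mul_sum] at h1
  have h2 : ∑ k ∈ Finset.Ioc A n, (k : ℝ)⁻¹ ≤ 1 + Real.log n := by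
    have h := harmonic_le_one_add_log n
    rw [harmonic_eq_sum_Icc] at h
    push_cast at h
    refine le_trans (Finset.sum_le_sum_of_subset_of_nonneg ?_ fun _ _ _ => by positivity) h
    intro k hk
    rw [Finset.mem_Ioc] at hk
    rw [Finset.mem_Icc]
    omega
  have h3 := hcount A le_rfl
  have h4 : 3 / 8 * (n : ℝ) ^ 2 * ∑ k ∈ Finset.Ioc A n, (k : ℝ)⁻¹
      ≤ 3 / 8 * (n : ℝ) ^ 2 * (1 + Real.log n) := by gcongr
  have h5 : 0 ≤ Real.log n := Real.log_natCast_nonneg n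
  nlinarith [sq_nonneg (n : ℝ), mul_nonneg (sq_nonneg (n : ℝ)) h5]

/-! ### Multiplicative energy and ratios -/

/-- The number of pairs `(u, v)` in `s × s` with `u = ρ v`, counted by `v`. It includes the pair
`(0, 0)`, for every `ρ`, if `0 ∈ s`. -/
noncomputable def ratioCount {F : Type*} [Field F] [DecidableEq F] (s : Finset F) (ρ : F) : ℕ :=
  (s.filter fun v => ρ * v ∈ s).card

theorem ratioCount_le_card {F : Type*} [Field F] [DecidableEq F] (s : Finset F) (ρ : F) :
    ratioCount s ρ ≤ s.card := Finset.card_filter_le _ _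

theorem one_le_ratioCount {F : Type*} [Field F] [DecidableEq F] {s : Finset F} (h0 : (0 : F) ∈ s)
    (ρ : F) :
    1 ≤ ratioCount s ρ :=
  Finset.card_pos.2 ⟨0, Finset.mem_filter.2 ⟨h0, by rwa [mul_zero]⟩⟩

theorem sum_ratioCount {F : Type*} [Field F] [Fintype F] [DecidableEq F] (s : Finset F) :
    ∑ ρ, (ratioCount s ρ : ℝ) = (s.card : ℝ) ^ 2
      + (if (0 : F) ∈ s then 1 else 0) * (Fintype.card F - s.card) := by
  have h1 : ∑ ρ, (ratioCount s ρ : ℝ)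
      = ∑ v ∈ s, ((Finset.univ.filter fun ρ => ρ * v ∈ s).card : ℝ) := by
    simp only [ratioCount, Finset.card_filter, Nat.cast_sum]
    rw [Finset.sum_comm]
  have h2 : ∀ v ∈ s, ((Finset.univ.filter fun ρ => ρ * v ∈ s).card : ℝ)
      = s.card + if v = 0 then (Fintype.card F - s.card : ℝ) else 0 := by
    intro v hv
    split_ifs with h
    · subst h
      simp [hv]
    · rw [add_zero]
      congr 1
      refine Finset.card_bij (fun ρ _ => ρ * v) (by simp) (fun a _ b _ hab =>
        mul_right_cancel₀ h hab) fun u hu => ⟨u / v, ?_, by field_simp⟩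
      simp [div_mul_cancel₀ _ h, hu]
  rw [h1, Finset.sum_congr rfl h2, Finset.sum_add_distrib, Finset.sum_const, nsmul_eq_mul,
    Finset.sum_ite_eq' s (0 : F), sq]
  split_ifs <;> simp

/-- The multiplicative energy as a second moment of `ratioCount`. A quadruple
`u₁ v₂ = u₂ v₁` has exactly one common ratio unless `v₁ = v₂ = 0`; in that case all `n ^ 2` choices
of `(u₁, u₂)` count for the energy, while on the right only `u₁ = u₂ = 0` counts, once for each
element of the field. -/
theorem mulEnergy_eq_sum_ratioCount_sq_add {F : Type*} [Field F] [Fintype F] [DecidableEq F]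
    (s : Finset F) :
    (Finset.mulEnergy s s : ℝ) = ∑ ρ, (ratioCount s ρ : ℝ) ^ 2
      + (if (0 : F) ∈ s then 1 else 0) * ((s.card : ℝ) ^ 2 - Fintype.card F) := by
  have h1 : ∑ ρ, (ratioCount s ρ : ℝ) ^ 2 = ∑ v ∈ s ×ˢ s,
      ((Finset.univ.filter fun ρ => ρ * v.1 ∈ s ∧ ρ * v.2 ∈ s).card : ℝ) := by
    simp only [ratioCount, sq, ← Nat.cast_mul, ← Finset.card_product, ← Finset.filter_product]
    simp only [Finset.card_filter, Nat.cast_sum]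
    rw [Finset.sum_comm]
  have h2 : (Finset.mulEnergy s s : ℝ) = ∑ v ∈ s ×ˢ s,
      (((s ×ˢ s).filter fun u => u.1 * v.2 = u.2 * v.1).card : ℝ) := by
    rw [Finset.mulEnergy, ← Nat.cast_sum]
    congr 1
    rw [Finset.card_filter, Finset.sum_product, Finset.sum_comm]
    simp only [Finset.card_filter]
    -- exchange the roles of the two second factors
    refine Finset.sum_nbij' Prod.swap Prod.swap ?_ ?_ ?_ ?_ ?_ <;> simp +contextual
  have h3 : ∀ v ∈ s ×ˢ s, (((s ×ˢ s).filter fun u => u.1 * v.2 = u.2 * v.1).card : ℝ)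
      = ((Finset.univ.filter fun ρ => ρ * v.1 ∈ s ∧ ρ * v.2 ∈ s).card : ℝ)
        + if v = (0, 0) then (s.card : ℝ) ^ 2 - Fintype.card F else 0 := by
    rintro ⟨a, b⟩ hv
    rw [Finset.mem_product] at hv
    split_ifs with h
    · obtain ⟨rfl, rfl⟩ := Prod.mk.inj h
      simp [hv.1, sq]
    · rw [add_zero]
      congr 1
      symm
      refine Finset.card_bij (fun ρ _ => (ρ * a, ρ * b)) ?_ ?_ ?_
      · intro ρ hρ
        simp only [Finset.mem_filter, Finset.mem_univ, true_and] at hρ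
        simp only [Finset.mem_filter, Finset.mem_product]
        exact ⟨hρ, by ring⟩
      · intro ρ _ ρ' _ he
        obtain ⟨h1, h2⟩ := Prod.mk.inj he
        by_cases ha : a = 0
        · exact mul_right_cancel₀ (fun hb => h (by rw [ha, hb])) h2
        · exact mul_right_cancel₀ ha h1
      · rintro ⟨u, w⟩ hu
        simp only [Finset.mem_filter, Finset.mem_product] at hu
        obtain ⟨⟨hus, hws⟩, huw⟩ := hu
        by_cases ha : a = 0
        · have hb : b ≠ 0 := fun hb => h (by rw [ha, hb])
          have hu0 : u = 0 := by
            rw [ha, mul_zero] at huw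
            exact (mul_eq_zero.1 huw).resolve_right hb
          refine ⟨w / b, ?_, ?_⟩
          · simp [ha, div_mul_cancel₀ _ hb, hws, hu0 ▸ hus]
          · simp [ha, div_mul_cancel₀ _ hb, hu0]
        · have hw : u / a * b = w := by field_simp; linear_combination huw
          refine ⟨u / a, ?_, ?_⟩
          · simp [hw, div_mul_cancel₀ _ ha, hus, hws]
          · simp [hw, div_mul_cancel₀ _ ha]
  rw [h1, h2, Finset.sum_congr rfl h3, Finset.sum_add_distrib, Finset.sum_ite_eq']
  congr 1
  simp

/-! ### The variance over pairs of `n`-th powers -/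

/-- The non-zero `n`-th powers in `𝔽_p`. -/
noncomputable def nonzeroPowers (p : ℕ) [Fact p.Prime] (n : ℕ) : Finset (ZMod p) :=
  (Finset.univ.filter fun x : ZMod p => x ≠ 0).image (· ^ n)

theorem mem_nonzeroPowers {p : ℕ} [Fact p.Prime] {n : ℕ} {a : ZMod p} :
    a ∈ nonzeroPowers p n ↔ ∃ x ≠ 0, x ^ n = a := by
  simp [nonzeroPowers]

theorem ne_zero_of_mem_nonzeroPowers {p : ℕ} [Fact p.Prime] {n : ℕ} {a : ZMod p}
    (h : a ∈ nonzeroPowers p n) : a ≠ 0 := by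
  obtain ⟨x, hx, rfl⟩ := mem_nonzeroPowers.1 h
  exact pow_ne_zero _ hx

theorem pow_mem_nonzeroPowers_iff {p : ℕ} [Fact p.Prime] {n : ℕ} (hn : 0 < n) {x : ZMod p} :
    x ^ n ∈ nonzeroPowers p n ↔ x ≠ 0 :=
  ⟨fun h hx => ne_zero_of_mem_nonzeroPowers h (by simp [hx, hn.ne']),
    fun h => mem_nonzeroPowers.2 ⟨x, h, rfl⟩⟩

theorem card_filter_ne_zero_ne_one {p : ℕ} [Fact p.Prime] :
    (Finset.univ.filter fun z : ZMod p => z ≠ 0 ∧ z ≠ 1).card = p - 2 := by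
  have : (Finset.univ.filter fun z : ZMod p => z ≠ 0 ∧ z ≠ 1)
      = (Finset.univ.erase 0).erase 1 := by
    ext z; simp [and_comm]
  rw [this, Finset.card_erase_of_mem (by simp), Finset.card_erase_of_mem (by simp),
    Finset.card_univ, ZMod.card]
  omega

theorem card_nonzeroPowers_mul {p : ℕ} [Fact p.Prime] {n : ℕ}
    (hn : (Finset.univ.filter fun x : ZMod p => x ^ n = 1).card = n) :
    (nonzeroPowers p n).card * n = p - 1 := by
  have hc : (Finset.univ.filter fun x : ZMod p => x ≠ 0).card = p - 1 := by
    rw [Finset.filter_ne', Finset.card_erase_of_mem (by simp), Finset.card_univ, ZMod.card]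
  rw [← hc, Finset.card_eq_sum_card_image (· ^ n) (Finset.univ.filter fun x : ZMod p => x ≠ 0)]
  refine (Finset.sum_const_nat (m := n) fun a ha => ?_).symm
  obtain ⟨x, hx, rfl⟩ := mem_nonzeroPowers.1 ha
  conv_rhs => rw [← hn]
  symm
  refine Finset.card_bij (fun y _ => y * x) ?_ (fun a _ b _ h => mul_right_cancel₀ hx h) ?_
  · intro y hy
    simp only [Finset.mem_filter, Finset.mem_univ, true_and] at hy ⊢
    refine ⟨mul_ne_zero ?_ hx, by rw [mul_pow, hy, one_mul]⟩
    rintro rfl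
    have hn0 : n ≠ 0 := by
      rintro rfl
      rw [Finset.card_eq_zero] at hn
      simpa using (Finset.ext_iff.1 hn) 1
    simp [hn0] at hy
  · intro y hy
    simp only [Finset.mem_filter, Finset.mem_univ, true_and] at hy
    refine ⟨y / x, ?_, div_mul_cancel₀ _ hx⟩
    simp only [Finset.mem_filter, Finset.mem_univ, true_and]
    rw [div_pow, hy.2, div_self (pow_ne_zero _ hx)]

theorem mem_product_nonzeroPowers_iff {p : ℕ} [Fact p.Prime] {n : ℕ} (hn : 0 < n) {z : ZMod p} :
    (z ^ n, (1 - z) ^ n) ∈ nonzeroPowers p n ×ˢ nonzeroPowers p n ↔ z ≠ 0 ∧ z ≠ 1 := by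
  rw [Finset.mem_product, pow_mem_nonzeroPowers_iff hn, pow_mem_nonzeroPowers_iff hn, sub_ne_zero]
  exact and_congr_right fun _ => ne_comm

theorem sum_eq_sum_fermatCount_mul {p : ℕ} [Fact p.Prime] {n : ℕ} (hn : 0 < n)
    (f : ZMod p × ZMod p → ℝ) :
    ∑ z : ZMod p with z ≠ 0 ∧ z ≠ 1, f (z ^ n, (1 - z) ^ n)
      = ∑ q ∈ nonzeroPowers p n ×ˢ nonzeroPowers p n, fermatCount n q * f q := by
  rw [← Finset.sum_fiberwise_of_maps_to (t := nonzeroPowers p n ×ˢ nonzeroPowers p n)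
    (g := fun z : ZMod p => (z ^ n, (1 - z) ^ n))
    (fun z hz => (mem_product_nonzeroPowers_iff hn).2 (by simpa using hz))]
  refine Finset.sum_congr rfl fun q hq => ?_
  rw [Finset.sum_congr rfl fun z hz => by rw [(Finset.mem_filter.1 hz).2], Finset.sum_const,
    nsmul_eq_mul, fermatCount, Finset.filter_filter]
  congr 3
  ext z
  simp only [Finset.mem_filter, Finset.mem_univ, true_and]
  exact ⟨fun h => h.2, fun h => ⟨(mem_product_nonzeroPowers_iff hn).1 (h ▸ hq), h⟩⟩

/-- Second moment of `fermatCount`. It counts the pairs `(z, w)` for which `g = w / z` and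
`h = (1 - w) / (1 - z)` are `n`-th roots of unity; a pair with `w ≠ z` is determined by `g ≠ 1` and
`h ≠ 1`. -/
theorem sum_fermatCount_sq_le {p : ℕ} [Fact p.Prime] {n : ℕ}
    (hn : (Finset.univ.filter fun x : ZMod p => x ^ n = 1).card = n) (hn0 : 0 < n) :
    ∑ q ∈ nonzeroPowers p n ×ˢ nonzeroPowers p n, (fermatCount n q : ℝ) ^ 2
      ≤ (p - 2 : ℕ) + ((n - 1 : ℕ) : ℝ) ^ 2 := by
  simp_rw [sq (fermatCount n _ : ℝ)]
  rw [← sum_eq_sum_fermatCount_mul hn0 fun q => (fermatCount n q : ℝ)]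
  rw [← Nat.cast_sum, ← Nat.cast_pow, ← Nat.cast_add, Nat.cast_le]
  simp only [fermatCount]
  rw [← Finset.card_sigma]
  set Z := (Finset.univ.filter fun z : ZMod p => z ≠ 0 ∧ z ≠ 1) with hZ
  set μ := (Finset.univ.filter fun x : ZMod p => x ^ n = 1).erase 1 with hμ
  have hμc : μ.card = n - 1 := by
    rw [hμ, Finset.card_erase_of_mem (by simp), hn]
  set T := Z.sigma fun z => Finset.univ.filter fun w : ZMod p =>
    (w ^ n, (1 - w) ^ n) = (z ^ n, (1 - z) ^ n) with hT
  rw [← Finset.card_filter_add_card_filter_not (s := T) (fun t => t.2 = t.1)]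
  refine Nat.add_le_add ?_ ?_
  · rw [← card_filter_ne_zero_ne_one (p := p)]
    refine Finset.card_le_card_of_injOn (fun t => t.1) ?_ ?_
    · intro t ht
      simp only [Finset.coe_filter, Set.mem_ofPred_eq, hT, Finset.mem_sigma] at ht
      exact ht.1.1
    · rintro ⟨z, w⟩ ht ⟨z', w'⟩ ht' h
      simp only [Finset.coe_filter, Set.mem_ofPred_eq] at ht ht' h
      obtain ⟨_, rfl⟩ := ht
      obtain ⟨_, rfl⟩ := ht'
      subst h
      rfl
  · rw [sq, ← hμc, ← Finset.card_product]
    have hmem : ∀ t ∈ T.filter fun t => ¬ t.2 = t.1, t.1 ≠ 0 ∧ 1 - t.1 ≠ 0 ∧ t.2 ≠ t.1 ∧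
        t.2 ^ n = t.1 ^ n ∧ (1 - t.2) ^ n = (1 - t.1) ^ n := by
      intro t ht
      simp only [hT, hZ, Finset.mem_filter, Finset.mem_sigma, Finset.mem_univ, true_and,
        Prod.mk.injEq] at ht
      exact ⟨ht.1.1.1, sub_ne_zero.2 (Ne.symm ht.1.1.2), ht.2, ht.1.2.1, ht.1.2.2⟩
    refine Finset.card_le_card_of_injOn (fun t => (t.2 / t.1, (1 - t.2) / (1 - t.1))) ?_ ?_
    · intro t ht
      obtain ⟨h1, h2, h3, h4, h5⟩ := hmem t ht
      simp only [hμ, Finset.coe_product, Set.mem_prod, Finset.mem_coe, Finset.mem_erase,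
        Finset.mem_filter, Finset.mem_univ, true_and, div_pow, h4, h5]
      refine ⟨⟨?_, div_self (pow_ne_zero _ h1)⟩, ?_, div_self (pow_ne_zero _ h2)⟩
      · rw [Ne, div_eq_one_iff_eq h1]; exact h3
      · rw [Ne, div_eq_one_iff_eq h2]; exact fun h => h3 (by linear_combination -h)
    · rintro ⟨z, w⟩ ht ⟨z', w'⟩ ht' h
      obtain ⟨h1, h2, h3, _, _⟩ := hmem _ ht
      obtain ⟨h1', h2', h3', _, _⟩ := hmem _ ht'
      simp only [Prod.mk.injEq] at h h1 h2 h3 h1' h2' h3'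
      obtain ⟨hg, hh⟩ := h
      rw [div_eq_div_iff h1 h1'] at hg
      rw [div_eq_div_iff h2 h2'] at hh
      have hwz : w - z ≠ 0 := sub_ne_zero.2 h3
      have hzz : z = z' := by
        have : (w - z) * (z - z') = 0 := by linear_combination (z - 1) * hg - z * hh
        exact sub_eq_zero.1 ((mul_eq_zero.1 this).resolve_left hwz)
      subst hzz
      have hww : w = w' := mul_right_cancel₀ h1 hg
      rw [hww]

theorem sum_comp_mul_nonzeroPowers {p : ℕ} [Fact p.Prime] {n : ℕ} {c : ZMod p}
    (hc : c ∈ nonzeroPowers p n) (f : ZMod p × ZMod p → ℝ) :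
    ∑ q ∈ nonzeroPowers p n ×ˢ nonzeroPowers p n, f (c * q.1, c * q.2)
      = ∑ q ∈ nonzeroPowers p n ×ˢ nonzeroPowers p n, f q := by
  obtain ⟨x, hx, rfl⟩ := mem_nonzeroPowers.1 hc
  have hmul : ∀ y : ZMod p, y ≠ 0 → ∀ a ∈ nonzeroPowers p n, y ^ n * a ∈ nonzeroPowers p n := by
    intro y hy a ha
    obtain ⟨z, hz, rfl⟩ := mem_nonzeroPowers.1 ha
    exact mem_nonzeroPowers.2 ⟨y * z, mul_ne_zero hy hz, mul_pow _ _ _⟩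
  have hxn := pow_ne_zero n hx
  refine Finset.sum_nbij' (fun q => (x ^ n * q.1, x ^ n * q.2))
    (fun q => (x⁻¹ ^ n * q.1, x⁻¹ ^ n * q.2)) ?_ ?_ ?_ ?_ ?_
  · intro q hq
    rw [Finset.mem_product] at hq ⊢
    exact ⟨hmul x hx _ hq.1, hmul x hx _ hq.2⟩
  · intro q hq
    rw [Finset.mem_product] at hq ⊢
    exact ⟨hmul _ (inv_ne_zero hx) _ hq.1, hmul _ (inv_ne_zero hx) _ hq.2⟩
  · intro q _
    ext <;> simp [inv_pow, inv_mul_cancel_left₀ hxn]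
  · intro q _
    ext <;> simp [inv_pow, mul_inv_cancel_left₀ hxn]
  · intro q _
    rfl

/-- The variance of `fermatCount` around `n ^ 2 / p`, summed over all `((p - 1) / n) ^ 2` pairs of
non-zero `n`-th powers, is at most `p`. -/
theorem sum_fermatCount_sub_sq_le {p : ℕ} [Fact p.Prime] {n : ℕ}
    (hn : (Finset.univ.filter fun x : ZMod p => x ^ n = 1).card = n) (hn0 : 0 < n) :
    ∑ q ∈ nonzeroPowers p n ×ˢ nonzeroPowers p n, ((fermatCount n q : ℝ) - (n : ℝ) ^ 2 / p) ^ 2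
      ≤ p := by
  have hp2 : 2 ≤ p := (Fact.out : p.Prime).two_le
  have h1 : ∑ q ∈ nonzeroPowers p n ×ˢ nonzeroPowers p n, (fermatCount n q : ℝ) = (p : ℝ) - 2 := by
    have h := sum_eq_sum_fermatCount_mul (p := p) hn0 fun _ => 1
    simp only [mul_one, Finset.sum_const, nsmul_eq_mul, card_filter_ne_zero_ne_one] at h
    rw [← h, Nat.cast_sub hp2]
    simp
  have h2 := sum_fermatCount_sq_le hn hn0
  rw [Nat.cast_sub hp2, Nat.cast_sub (by omega : 1 ≤ n)] at h2
  have hH : ((nonzeroPowers p n).card : ℝ) * n = p - 1 := by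
    have := card_nonzeroPowers_mul hn
    rw [← Nat.cast_mul, this, Nat.cast_sub (by omega)]
    simp
  set H : ℝ := ((nonzeroPowers p n).card : ℝ) with hHdef
  have hexp : ∑ q ∈ nonzeroPowers p n ×ˢ nonzeroPowers p n,
      ((fermatCount n q : ℝ) - (n : ℝ) ^ 2 / p) ^ 2
      = ∑ q ∈ nonzeroPowers p n ×ˢ nonzeroPowers p n, (fermatCount n q : ℝ) ^ 2
        - 2 * ((n : ℝ) ^ 2 / p) * (p - 2) + H * H * ((n : ℝ) ^ 2 / p) ^ 2 := by
    simp only [sub_sq]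
    rw [Finset.sum_add_distrib, Finset.sum_sub_distrib, Finset.sum_const, Finset.card_product,
      nsmul_eq_mul, ← h1, Finset.mul_sum]
    push_cast
    congr 2
    exact Finset.sum_congr rfl fun q _ => by ring
  rw [hexp]
  have hp0 : (0 : ℝ) < p := by exact_mod_cast (by omega : 0 < p)
  have hn1 : (1 : ℝ) ≤ n := by exact_mod_cast hn0
  have hnp : (n : ℝ) ≤ p := by
    rw [← hn]
    exact_mod_cast (Finset.card_le_univ _).trans (ZMod.card p).le
  set x : ℝ := (n : ℝ) / p with hx
  have hxn : (n : ℝ) = x * p := by rw [hx]; field_simp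
  have hx1 : x ≤ 1 := (div_le_one hp0).2 hnp
  have hx0 : 0 < x := by positivity
  have e1 : (n : ℝ) ^ 2 / p = n * x := by rw [hx]; ring
  have e2 : H * H * ((n : ℝ) ^ 2 / p) ^ 2 = (p - 1) ^ 2 * x ^ 2 := by rw [e1, ← hH]; ring
  rw [e2, e1]
  push_cast at h2 ⊢
  rw [hxn] at h2 hn1 ⊢
  nlinarith [mul_nonneg hx0.le (sub_nonneg.2 hx1), mul_pos hx0 hp0]

/-! ### The energy of a shifted subgroup -/

theorem exists_mem_subgroup_eq_iff_pow_card_eq_one {p : ℕ} [Fact p.Prime] (G : Subgroup (ZMod p)ˣ)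
    (x : ZMod p) : (∃ g ∈ G, x = (g : ZMod p)) ↔ x ^ Nat.card G = 1 := by
  classical
  have hn0 : 0 < Nat.card G := Nat.card_pos
  have hinj : Function.Injective fun g : G => ((g : (ZMod p)ˣ) : ZMod p) :=
    Units.val_injective.comp Subtype.val_injective
  have hsub : (Finset.univ.image fun g : G => ((g : (ZMod p)ˣ) : ZMod p))
      ⊆ (Polynomial.nthRoots (Nat.card G) (1 : ZMod p)).toFinset := by
    intro y hy
    obtain ⟨g, -, rfl⟩ := Finset.mem_image.1 hy
    rw [Multiset.mem_toFinset, Polynomial.mem_nthRoots hn0]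
    have h : (g : (ZMod p)ˣ) ^ Nat.card G = 1 := by
      rw [← Subgroup.coe_pow, pow_card_eq_one', Subgroup.coe_one]
    rw [← Units.val_pow_eq_pow_val, h, Units.val_one]
  have heq := Finset.eq_of_subset_of_card_le hsub (by
    rw [Finset.card_image_of_injective _ hinj, Finset.card_univ, ← Nat.card_eq_fintype_card]
    exact (Multiset.toFinset_card_le _).trans (Polynomial.card_nthRoots _ _))
  have h := Finset.ext_iff.1 heq x
  rw [Multiset.mem_toFinset, Polynomial.mem_nthRoots hn0, Finset.mem_image] at h
  rw [← h]
  constructor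
  · rintro ⟨g, hg, rfl⟩
    exact ⟨⟨g, hg⟩, by simp, rfl⟩
  · rintro ⟨g, -, rfl⟩
    exact ⟨g, g.2, rfl⟩

theorem card_filter_pow_card_eq_one {p : ℕ} [Fact p.Prime] (G : Subgroup (ZMod p)ˣ) :
    (Finset.univ.filter fun x : ZMod p => x ^ Nat.card G = 1).card = Nat.card G := by
  classical
  rw [Nat.card_eq_fintype_card, ← Finset.card_univ]
  symm
  refine Finset.card_bij (fun g _ => ((g : (ZMod p)ˣ) : ZMod p)) ?_ ?_ ?_
  · intro g _
    rw [Finset.mem_filter, Finset.card_univ, ← Nat.card_eq_fintype_card]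
    exact ⟨Finset.mem_univ _, (exists_mem_subgroup_eq_iff_pow_card_eq_one G _).1 ⟨g, g.2, rfl⟩⟩
  · intro g _ h _ hgh
    exact Subtype.ext (Units.ext hgh)
  · intro x hx
    rw [Finset.mem_filter, Finset.card_univ, ← Nat.card_eq_fintype_card] at hx
    obtain ⟨g, hg, rfl⟩ := (exists_mem_subgroup_eq_iff_pow_card_eq_one G _).2 hx.2
    exact ⟨⟨g, hg⟩, by simp, rfl⟩

theorem mem_shiftedSubgroup_iff {p : ℕ} [Fact p.Prime] (G : Subgroup (ZMod p)ˣ) (lam x : ZMod p) :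
    x ∈ shiftedSubgroup G lam ↔ (x - lam) ^ Nat.card G = 1 := by
  rw [← exists_mem_subgroup_eq_iff_pow_card_eq_one]
  simp [shiftedSubgroup, sub_eq_iff_eq_add]

theorem card_shiftedSubgroup {p : ℕ} [Fact p.Prime] (G : Subgroup (ZMod p)ˣ) (lam : ZMod p) :
    (shiftedSubgroup G lam).card = Nat.card G := by
  conv_rhs => rw [← card_filter_pow_card_eq_one G]
  refine Finset.card_nbij' (fun x => x - lam) (fun x => x + lam) ?_ ?_ ?_ ?_
  · intro x hx
    simpa [mem_shiftedSubgroup_iff] using hx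
  · intro x hx
    simpa [mem_shiftedSubgroup_iff] using hx
  · intro x _; simp
  · intro x _; simp

/-- For `ρ = 1 - 1 / z`, the equation `x + lam = ρ (y + lam)` with `x, y ∈ G` reads
`(-z / lam) x + (-(1 - z) / lam) y = 1`, so its number of solutions is a value of `fermatCount`. -/
theorem ratioCount_shiftedSubgroup {p : ℕ} [Fact p.Prime] (G : Subgroup (ZMod p)ˣ) {lam z : ZMod p}
    (hlam : lam ≠ 0) (hz0 : z ≠ 0) (hz1 : z ≠ 1) :
    ratioCount (shiftedSubgroup G lam) (1 - z⁻¹) = fermatCount (Nat.card G)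
      ((-lam⁻¹) ^ Nat.card G * z ^ Nat.card G, (-lam⁻¹) ^ Nat.card G * (1 - z) ^ Nat.card G) := by
  set ρ := 1 - z⁻¹ with hρ
  have hρ0 : ρ ≠ 0 := by
    rw [hρ, sub_ne_zero]
    exact fun h => hz1 (by rw [← inv_inv z, ← h, inv_one])
  have hρz : ρ * z = z - 1 := by rw [hρ]; field_simp
  have hz1' : 1 - z ≠ 0 := sub_ne_zero.2 (Ne.symm hz1)
  have hl : -lam⁻¹ ≠ 0 := neg_ne_zero.2 (inv_ne_zero hlam)
  have key : ∀ v : ZMod p, (v ∈ shiftedSubgroup G lam ∧ ρ * v ∈ shiftedSubgroup G lam) ↔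
      ((-lam⁻¹ * z * (ρ * v - lam)) ^ Nat.card G = (-lam⁻¹) ^ Nat.card G * z ^ Nat.card G ∧
       (1 - -lam⁻¹ * z * (ρ * v - lam)) ^ Nat.card G
        = (-lam⁻¹) ^ Nat.card G * (1 - z) ^ Nat.card G) := by
    intro v
    have h1 : 1 - -lam⁻¹ * z * (ρ * v - lam) = -lam⁻¹ * (1 - z) * (v - lam) := by
      have : lam⁻¹ * lam = 1 := inv_mul_cancel₀ hlam
      linear_combination lam⁻¹ * v * hρz + (-1) * this
    rw [h1, mul_pow (-lam⁻¹ * z) (ρ * v - lam), mul_pow (-lam⁻¹ * (1 - z)) (v - lam),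
      ← mul_pow (-lam⁻¹) z, ← mul_pow (-lam⁻¹) (1 - z),
      mul_eq_left₀ (pow_ne_zero _ (mul_ne_zero hl hz0)),
      mul_eq_left₀ (pow_ne_zero _ (mul_ne_zero hl hz1')), mem_shiftedSubgroup_iff,
      mem_shiftedSubgroup_iff, and_comm]
  rw [ratioCount, fermatCount]
  refine Finset.card_bij (fun v _ => -lam⁻¹ * z * (ρ * v - lam)) ?_ ?_ ?_
  · intro v hv
    rw [Finset.mem_filter] at hv
    simp only [Finset.mem_filter, Finset.mem_univ, true_and, Prod.mk.injEq]
    exact (key v).1 hv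
  · intro v _ v' _ h
    have h2 := mul_left_cancel₀ (mul_ne_zero hl hz0) h
    exact mul_left_cancel₀ hρ0 (sub_left_injective h2)
  · intro w hw
    simp only [Finset.mem_filter, Finset.mem_univ, true_and, Prod.mk.injEq] at hw
    have hinv : -lam⁻¹ * z * (ρ * ((lam - lam * w / z) / ρ) - lam) = w := by
      field_simp
      ring
    refine ⟨(lam - lam * w / z) / ρ, ?_, hinv⟩
    rw [Finset.mem_filter, key, hinv]
    exact hw

/-- Sums over the ratios `ρ ≠ 0, 1` become sums over pairs of `n`-th powers, in which the weight of
a pair is itself a value of `fermatCount`. So the second moment of `ratioCount` is controlled by a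
third moment of `fermatCount`. -/
theorem sum_comp_ratioCount {p : ℕ} [Fact p.Prime] (G : Subgroup (ZMod p)ˣ) {lam : ZMod p}
    (hlam : lam ≠ 0) (f : ℕ → ℝ) :
    ∑ ρ, f (ratioCount (shiftedSubgroup G lam) ρ)
      = f (ratioCount (shiftedSubgroup G lam) 0) + f (ratioCount (shiftedSubgroup G lam) 1)
        + ∑ q ∈ nonzeroPowers p (Nat.card G) ×ˢ nonzeroPowers p (Nat.card G),
          fermatCount (Nat.card G) q * f (fermatCount (Nat.card G)
            ((-lam⁻¹) ^ Nat.card G * q.1, (-lam⁻¹) ^ Nat.card G * q.2)) := by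
  rw [← sum_eq_sum_fermatCount_mul Nat.card_pos fun q => f (fermatCount (Nat.card G)
            ((-lam⁻¹) ^ Nat.card G * q.1, (-lam⁻¹) ^ Nat.card G * q.2)),
    ← Finset.add_sum_erase _ _ (Finset.mem_univ (0 : ZMod p)),
    ← Finset.add_sum_erase _ _ (Finset.mem_erase.2 ⟨one_ne_zero, Finset.mem_univ (1 : ZMod p)⟩),
    ← add_assoc]
  congr 1
  refine Finset.sum_nbij' (fun ρ => (1 - ρ)⁻¹) (fun z => 1 - z⁻¹) ?_ ?_ ?_ ?_ ?_
  · intro ρ hρ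
    simp only [Finset.mem_erase, Finset.mem_univ, and_true] at hρ
    simp only [Finset.mem_filter, Finset.mem_univ, true_and]
    refine ⟨inv_ne_zero (sub_ne_zero.2 (Ne.symm hρ.1)), fun h => hρ.2 ?_⟩
    rw [inv_eq_one] at h
    linear_combination -h
  · intro z hz
    simp only [Finset.mem_filter, Finset.mem_univ, true_and] at hz
    simp only [Finset.mem_erase, Finset.mem_univ, and_true]
    refine ⟨fun h => inv_ne_zero hz.1 (by linear_combination -h), fun h => hz.2 ?_⟩
    rw [← inv_inv z, ← sub_eq_zero.1 h, inv_one]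
  · intro ρ _; simp
  · intro z _; simp
  · intro ρ hρ
    simp only [Finset.mem_erase, Finset.mem_univ, and_true] at hρ
    have h := ratioCount_shiftedSubgroup G hlam
      (z := (1 - ρ)⁻¹) (inv_ne_zero (sub_ne_zero.2 (Ne.symm hρ.1))) (fun h => hρ.2 (by
        rw [inv_eq_one] at h
        linear_combination -h))
    rw [inv_inv, sub_sub_cancel] at h
    rw [h]

theorem neg_inv_pow_mem_nonzeroPowers {p : ℕ} [Fact p.Prime] {lam : ZMod p} (hlam : lam ≠ 0)
    (n : ℕ) : (-lam⁻¹) ^ n ∈ nonzeroPowers p n :=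
  mem_nonzeroPowers.2 ⟨_, neg_ne_zero.2 (inv_ne_zero hlam), rfl⟩

theorem card_subgroup_lt {p : ℕ} [Fact p.Prime] (G : Subgroup (ZMod p)ˣ) : Nat.card G < p := by
  have h := Subgroup.card_le_card_group G
  rw [Nat.card_eq_fintype_card (α := (ZMod p)ˣ), ZMod.card_units] at h
  have := (Fact.out : p.Prime).two_le
  omega

/-- If `p ≤ n ^ 2`, the error term of the energy is a weighted variance of `fermatCount`, up to
`O(n ^ 2)`. -/
theorem abs_shiftedEnergy_sub_le {p : ℕ} [Fact p.Prime] (G : Subgroup (ZMod p)ˣ) {lam : ZMod p}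
    (hlam : lam ≠ 0) (hp : (p : ℝ) ≤ (Nat.card G : ℝ) ^ 2) :
    |(shiftedEnergy G lam : ℝ) - (Nat.card G : ℝ) ^ 4 / p| ≤ 5 * (Nat.card G : ℝ) ^ 2
      + ∑ q ∈ nonzeroPowers p (Nat.card G) ×ˢ nonzeroPowers p (Nat.card G),
          (fermatCount (Nat.card G) q : ℝ) * ((fermatCount (Nat.card G)
            ((-lam⁻¹) ^ Nat.card G * q.1, (-lam⁻¹) ^ Nat.card G * q.2) : ℝ)
              - (Nat.card G : ℝ) ^ 2 / p) ^ 2 := by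
  set n := Nat.card G with hn
  set S := shiftedSubgroup G lam with hS
  have hSc : S.card = n := card_shiftedSubgroup G lam
  have hE := mulEnergy_eq_sum_ratioCount_sq_add S
  have hR := sum_ratioCount S
  have hsum := sum_comp_ratioCount G hlam fun r => ((r : ℝ) - (n : ℝ) ^ 2 / p) ^ 2
  rw [← hS, ← hn] at hsum
  set V := ∑ q ∈ nonzeroPowers p n ×ˢ nonzeroPowers p n, (fermatCount n q : ℝ) *
    ((fermatCount n ((-lam⁻¹) ^ n * q.1, (-lam⁻¹) ^ n * q.2) : ℝ) - (n : ℝ) ^ 2 / p) ^ 2 with hV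
  rw [hSc, ZMod.card] at hE hR
  have hp0 : (0 : ℝ) < p := by exact_mod_cast (Fact.out : p.Prime).pos
  have hnp : (n : ℝ) ≤ p := by exact_mod_cast (card_subgroup_lt G).le
  have hn0 : (0 : ℝ) ≤ n := Nat.cast_nonneg n
  have hV0 : 0 ≤ V := Finset.sum_nonneg fun q _ => by positivity
  have hexp : ∑ ρ, ((ratioCount S ρ : ℝ) - (n : ℝ) ^ 2 / p) ^ 2
      = ∑ ρ, (ratioCount S ρ : ℝ) ^ 2 - 2 * ((n : ℝ) ^ 2 / p) * ∑ ρ, (ratioCount S ρ : ℝ)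
        + p * ((n : ℝ) ^ 2 / p) ^ 2 := by
    simp only [sub_sq]
    rw [Finset.sum_add_distrib, Finset.sum_sub_distrib, Finset.sum_const, Finset.card_univ,
      ZMod.card, nsmul_eq_mul, Finset.mul_sum]
    congr 2
    exact Finset.sum_congr rfl fun q _ => by ring
  have hm0 : 0 ≤ (n : ℝ) ^ 2 / p := by positivity
  have hmn : (n : ℝ) ^ 2 / p ≤ n := by
    rw [div_le_iff₀ hp0]; nlinarith
  have hbd : ∀ ρ, ((ratioCount S ρ : ℝ) - (n : ℝ) ^ 2 / p) ^ 2 ≤ (n : ℝ) ^ 2 := by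
    intro ρ
    have h1 : (ratioCount S ρ : ℝ) ≤ n := by
      rw [← hSc]; exact_mod_cast ratioCount_le_card S ρ
    have h2 : (0 : ℝ) ≤ ratioCount S ρ := Nat.cast_nonneg _
    exact sq_le_sq' (by linarith) (by linarith)
  have hb0 := hbd 0
  have hb1 := hbd 1
  have hb0' := sq_nonneg ((ratioCount S 0 : ℝ) - (n : ℝ) ^ 2 / p)
  have hb1' := sq_nonneg ((ratioCount S 1 : ℝ) - (n : ℝ) ^ 2 / p)
  have hEdef : (shiftedEnergy G lam : ℝ) = (Finset.mulEnergy S S : ℝ) := rfl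
  set m := (n : ℝ) ^ 2 / p with hm
  have hmp : m * p = (n : ℝ) ^ 2 := by rw [hm]; field_simp
  have hn4 : (n : ℝ) ^ 4 / p = m * (n : ℝ) ^ 2 := by rw [hm]; ring
  -- `d` records whether the degenerate solutions with `u = v = 0` occur
  set d : ℝ := if (0 : ZMod p) ∈ S then 1 else 0 with hd
  have hd01 : d = 0 ∨ d = 1 := by
    rw [hd]; split_ifs <;> simp
  have hmain : (shiftedEnergy G lam : ℝ) - m * (n : ℝ) ^ 2
      = (((ratioCount S 0 : ℝ) - m) ^ 2 + ((ratioCount S 1 : ℝ) - m) ^ 2 + V)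
        + d * (2 * (n : ℝ) ^ 2 - 2 * m * n + (n : ℝ) ^ 2 - p) := by
    rw [← hsum, hexp, hEdef, hE, hR]
    linear_combination (2 * d - m) * hmp
  have hmn2 : m * n ≤ (n : ℝ) ^ 2 := by rw [sq]; exact mul_le_mul_of_nonneg_right hmn hn0
  have hmn0 : 0 ≤ m * n := by positivity
  rw [hn4, hmain, abs_le]
  rcases hd01 with h | h <;> rw [h] <;> constructor <;> linarith

/-- Upper bound for the energy in which only the ratios with more than `D` representations enter
the second moment. It serves for `n ^ 2 < p`, where the main term `n ^ 4 / p` is at most `n ^ 2`. -/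
theorem shiftedEnergy_le {p : ℕ} [Fact p.Prime] (G : Subgroup (ZMod p)ˣ) {lam : ZMod p}
    (hlam : lam ≠ 0) (D : ℕ) :
    (shiftedEnergy G lam : ℝ) ≤ (D + 4) * (Nat.card G : ℝ) ^ 2
      + ∑ q ∈ nonzeroPowers p (Nat.card G) ×ˢ nonzeroPowers p (Nat.card G),
          (fermatCount (Nat.card G) q : ℝ) * (if D < fermatCount (Nat.card G)
            ((-lam⁻¹) ^ Nat.card G * q.1, (-lam⁻¹) ^ Nat.card G * q.2) then
            (fermatCount (Nat.card G)
            ((-lam⁻¹) ^ Nat.card G * q.1, (-lam⁻¹) ^ Nat.card G * q.2) : ℝ) ^ 2 else 0) := by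
  set n := Nat.card G with hn
  set S := shiftedSubgroup G lam with hS
  have hSc : S.card = n := card_shiftedSubgroup G lam
  have hE := mulEnergy_eq_sum_ratioCount_sq_add S
  have hR := sum_ratioCount S
  have hsum := sum_comp_ratioCount G hlam fun r => if D < r then (r : ℝ) ^ 2 else 0
  rw [← hS, ← hn] at hsum
  rw [hSc, ZMod.card] at hE hR
  have hbd : ∀ ρ, (if D < ratioCount S ρ then (ratioCount S ρ : ℝ) ^ 2 else 0) ≤ (n : ℝ) ^ 2 := by
    intro ρ
    have h1 : (ratioCount S ρ : ℝ) ≤ n := by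
      rw [← hSc]; exact_mod_cast ratioCount_le_card S ρ
    split_ifs
    · gcongr
    · positivity
  have hb0 := hbd 0
  have hb1 := hbd 1
  set d : ℝ := if (0 : ZMod p) ∈ S then 1 else 0 with hd
  have hd01 : d = 0 ∨ d = 1 := by
    rw [hd]; split_ifs <;> simp
  -- subtracting the trivial solution is essential here, since `p` may exceed `n ^ 2`
  have hRd : ∀ ρ, d ≤ ratioCount S ρ := by
    intro ρ
    rw [hd]
    split_ifs with h
    · exact_mod_cast one_le_ratioCount h ρ
    · positivity
  have hpt : ∀ ρ, (ratioCount S ρ : ℝ) ^ 2 - d ≤ (D + 1) * ((ratioCount S ρ : ℝ) - d)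
      + if D < ratioCount S ρ then (ratioCount S ρ : ℝ) ^ 2 else 0 := by
    intro ρ
    have h1 := hRd ρ
    have hD0 : (0 : ℝ) ≤ D := Nat.cast_nonneg D
    split_ifs with h
    · rcases hd01 with h' | h' <;> rw [h'] at h1 ⊢ <;> nlinarith
    · have h2 : (ratioCount S ρ : ℝ) ≤ D := by exact_mod_cast not_lt.1 h
      rcases hd01 with h' | h' <;> rw [h'] at h1 ⊢ <;> nlinarith
  have hs := Finset.sum_le_sum fun ρ (_ : ρ ∈ Finset.univ) => hpt ρ
  rw [Finset.sum_add_distrib, ← Finset.mul_sum, Finset.sum_sub_distrib, Finset.sum_sub_distrib,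
    hsum, hR, Finset.sum_const, Finset.card_univ, ZMod.card, nsmul_eq_mul] at hs
  have hEdef : (shiftedEnergy G lam : ℝ) = (Finset.mulEnergy S S : ℝ) := rfl
  rw [hEdef, hE]
  have hn0 : (0 : ℝ) ≤ n := Nat.cast_nonneg n
  have hD0 : (0 : ℝ) ≤ D := Nat.cast_nonneg D
  rcases hd01 with h | h <;> rw [h] at hs ⊢ <;> nlinarith [mul_nonneg hD0 hn0]

/-! ### Bounds for the error term -/

theorem forall_mem_product_nonzeroPowers_ne_zero {p : ℕ} [Fact p.Prime] (n : ℕ) :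
    ∀ q ∈ nonzeroPowers p n ×ˢ nonzeroPowers p n, q.1 ≠ 0 ∧ q.2 ≠ 0 := by
  intro q hq
  rw [Finset.mem_product] at hq
  exact ⟨ne_zero_of_mem_nonzeroPowers hq.1, ne_zero_of_mem_nonzeroPowers hq.2⟩

/-- Bound from the variance alone; it is sharp enough for `n` of order at least `p ^ (2 / 3)`. -/
theorem abs_shiftedEnergy_sub_le_of_le_sq {p : ℕ} [Fact p.Prime] (G : Subgroup (ZMod p)ˣ)
    {lam : ZMod p} (hlam : lam ≠ 0) (hp : (p : ℝ) ≤ (Nat.card G : ℝ) ^ 2) :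
    |(shiftedEnergy G lam : ℝ) - (Nat.card G : ℝ) ^ 4 / p|
      ≤ 6 * (Nat.card G : ℝ) ^ 2 + p * √p := by
  refine (abs_shiftedEnergy_sub_le G hlam hp).trans ?_
  have hvar := sum_fermatCount_sub_sq_le (card_filter_pow_card_eq_one G) Nat.card_pos
  set n := Nat.card G with hn
  have hp0 : (0 : ℝ) < p := by exact_mod_cast (Fact.out : p.Prime).pos
  have hc := neg_inv_pow_mem_nonzeroPowers hlam n
  have hle : ∑ q ∈ nonzeroPowers p n ×ˢ nonzeroPowers p n, (fermatCount n q : ℝ) *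
      ((fermatCount n ((-lam⁻¹) ^ n * q.1, (-lam⁻¹) ^ n * q.2) : ℝ) - (n : ℝ) ^ 2 / p) ^ 2
      ≤ ∑ q ∈ nonzeroPowers p n ×ˢ nonzeroPowers p n, ((n : ℝ) ^ 2 / p + √p) *
      ((fermatCount n ((-lam⁻¹) ^ n * q.1, (-lam⁻¹) ^ n * q.2) : ℝ) - (n : ℝ) ^ 2 / p) ^ 2 := by
    refine Finset.sum_le_sum fun q hq => mul_le_mul_of_nonneg_right ?_ (sq_nonneg _)
    -- a single term of the variance is already at most `p`
    have h1 : ((fermatCount n q : ℝ) - (n : ℝ) ^ 2 / p) ^ 2 ≤ p :=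
      (Finset.single_le_sum (f := fun q => ((fermatCount n q : ℝ) - (n : ℝ) ^ 2 / p) ^ 2)
        (fun _ _ => sq_nonneg _) hq).trans hvar
    have h2 := Real.le_sqrt_of_sq_le h1
    linarith
  rw [← Finset.mul_sum, sum_comp_mul_nonzeroPowers hc
    fun q => ((fermatCount n q : ℝ) - (n : ℝ) ^ 2 / p) ^ 2] at hle
  have h3 : ((n : ℝ) ^ 2 / p + √p) * ∑ q ∈ nonzeroPowers p n ×ˢ nonzeroPowers p n,
      ((fermatCount n q : ℝ) - (n : ℝ) ^ 2 / p) ^ 2 ≤ ((n : ℝ) ^ 2 / p + √p) * p := by gcongr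
  have h4 : ((n : ℝ) ^ 2 / p + √p) * p = (n : ℝ) ^ 2 + p * √p := by field_simp
  linarith

/-- Bound from the variance and Stepanov's method: the weights up to `192 A` are treated by the
variance, the larger ones by the third moment. -/
theorem abs_shiftedEnergy_sub_le_of_rich {p : ℕ} [Fact p.Prime] (G : Subgroup (ZMod p)ˣ)
    {lam : ZMod p} (hlam : lam ≠ 0) (hp : (p : ℝ) ≤ (Nat.card G : ℝ) ^ 2) {A : ℕ} (hA : 0 < A)
    (hpA : Nat.card G ^ 2 ≤ p * A) (hn3 : 512 * Nat.card G ^ 3 ≤ p ^ 2) :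
    |(shiftedEnergy G lam : ℝ) - (Nat.card G : ℝ) ^ 4 / p| ≤ 5 * (Nat.card G : ℝ) ^ 2
      + 192 * (p * A) + 2 * 384 ^ 3 * ((Nat.card G : ℝ) ^ 2 * (1 + Real.log (Nat.card G))) := by
  refine (abs_shiftedEnergy_sub_le G hlam hp).trans ?_
  have hvar := sum_fermatCount_sub_sq_le (card_filter_pow_card_eq_one G) Nat.card_pos
  have hrich := sum_fermatCount_pow_three_le Nat.card_pos hA (card_subgroup_lt G).le hpA hn3
    _ (forall_mem_product_nonzeroPowers_ne_zero (Nat.card G))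
  set n := Nat.card G with hn
  have hp0 : (0 : ℝ) < p := by exact_mod_cast (Fact.out : p.Prime).pos
  have hc := neg_inv_pow_mem_nonzeroPowers hlam n
  set m := (n : ℝ) ^ 2 / p with hm
  have hmA : m ≤ A := by
    rw [hm, div_le_iff₀ hp0, mul_comm]
    exact_mod_cast hpA
  have hm0 : 0 ≤ m := by positivity
  let F : ZMod p × ZMod p → ℝ := fun q =>
    if 192 * A < fermatCount n q then (fermatCount n q : ℝ) ^ 3 else 0
  -- a large weight is dominated by its own cube or by that of the shifted count
  have hpt : ∀ q ∈ nonzeroPowers p n ×ˢ nonzeroPowers p n, (fermatCount n q : ℝ) *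
      ((fermatCount n ((-lam⁻¹) ^ n * q.1, (-lam⁻¹) ^ n * q.2) : ℝ) - m) ^ 2
      ≤ 192 * A * ((fermatCount n ((-lam⁻¹) ^ n * q.1, (-lam⁻¹) ^ n * q.2) : ℝ) - m) ^ 2
        + F q + F ((-lam⁻¹) ^ n * q.1, (-lam⁻¹) ^ n * q.2) := by
    intro q _
    simp only [F]
    set M := fermatCount n q
    set N := fermatCount n ((-lam⁻¹) ^ n * q.1, (-lam⁻¹) ^ n * q.2)
    have hN0 : (0 : ℝ) ≤ N := Nat.cast_nonneg N
    have hM0 : (0 : ℝ) ≤ M := Nat.cast_nonneg M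
    have hFN : (0 : ℝ) ≤ if 192 * A < N then (N : ℝ) ^ 3 else 0 := by split_ifs <;> positivity
    by_cases h : 192 * A < M
    · rw [if_pos h]
      have hM : (192 * A : ℝ) < M := by exact_mod_cast h
      have hA0 : (0 : ℝ) ≤ A := Nat.cast_nonneg A
      have hmM : m ≤ M := by linarith
      have h0 : 0 ≤ 192 * (A : ℝ) * ((N : ℝ) - m) ^ 2 := by positivity
      rcases le_or_gt N M with hNM | hNM
      · have hNM' : (N : ℝ) ≤ M := by exact_mod_cast hNM
        have h1 : ((N : ℝ) - m) ^ 2 ≤ (M : ℝ) ^ 2 := sq_le_sq' (by linarith) (by linarith)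
        have h2 : (M : ℝ) * ((N : ℝ) - m) ^ 2 ≤ M * (M : ℝ) ^ 2 := by gcongr
        linarith [h2, pow_succ' (M : ℝ) 2]
      · rw [if_pos (h.trans hNM)]
        have hNM' : (M : ℝ) ≤ N := by exact_mod_cast hNM.le
        have h1 : ((N : ℝ) - m) ^ 2 ≤ (N : ℝ) ^ 2 := sq_le_sq' (by linarith) (by linarith)
        have h2 : (M : ℝ) * ((N : ℝ) - m) ^ 2 ≤ N * (N : ℝ) ^ 2 := by gcongr
        have h3 : (0 : ℝ) ≤ (M : ℝ) ^ 3 := by positivity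
        linarith [h2, pow_succ' (N : ℝ) 2]
    · rw [if_neg h]
      have hM : (M : ℝ) ≤ 192 * A := by exact_mod_cast not_lt.1 h
      have := mul_le_mul_of_nonneg_right hM (sq_nonneg ((N : ℝ) - m))
      linarith
  have hs := Finset.sum_le_sum hpt
  rw [Finset.sum_add_distrib, Finset.sum_add_distrib, ← Finset.mul_sum,
    sum_comp_mul_nonzeroPowers hc fun q => ((fermatCount n q : ℝ) - m) ^ 2,
    sum_comp_mul_nonzeroPowers hc F] at hs
  have hF : ∑ q ∈ nonzeroPowers p n ×ˢ nonzeroPowers p n, F q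
      ≤ 384 ^ 3 * ((n : ℝ) ^ 2 * (1 + Real.log n)) := by
    simp only [F]
    rw [← Finset.sum_filter]
    exact hrich
  have h5 : 192 * (A : ℝ) * ∑ q ∈ nonzeroPowers p n ×ˢ nonzeroPowers p n,
      ((fermatCount n q : ℝ) - m) ^ 2 ≤ 192 * (A : ℝ) * p := by gcongr
  linarith

theorem shiftedEnergy_le_of_sq_le {p : ℕ} [Fact p.Prime] (G : Subgroup (ZMod p)ˣ)
    {lam : ZMod p} (hlam : lam ≠ 0) (hp : Nat.card G ^ 2 ≤ p) (hn3 : 512 * Nat.card G ^ 3 ≤ p ^ 2) :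
    (shiftedEnergy G lam : ℝ) ≤ 196 * (Nat.card G : ℝ) ^ 2
      + 2 * 384 ^ 3 * ((Nat.card G : ℝ) ^ 2 * (1 + Real.log (Nat.card G))) := by
  refine (shiftedEnergy_le G hlam (192 * 1)).trans ?_
  have hrich := sum_fermatCount_pow_three_le Nat.card_pos one_pos (card_subgroup_lt G).le
    (by simpa using hp) hn3 _ (forall_mem_product_nonzeroPowers_ne_zero (Nat.card G))
  set n := Nat.card G with hn
  have hc := neg_inv_pow_mem_nonzeroPowers hlam n
  let F : ZMod p × ZMod p → ℝ := fun q =>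
    if 192 * 1 < fermatCount n q then (fermatCount n q : ℝ) ^ 3 else 0
  have hpt : ∀ q ∈ nonzeroPowers p n ×ˢ nonzeroPowers p n, (fermatCount n q : ℝ) *
      (if 192 * 1 < fermatCount n ((-lam⁻¹) ^ n * q.1, (-lam⁻¹) ^ n * q.2) then
        (fermatCount n ((-lam⁻¹) ^ n * q.1, (-lam⁻¹) ^ n * q.2) : ℝ) ^ 2 else 0)
      ≤ F q + F ((-lam⁻¹) ^ n * q.1, (-lam⁻¹) ^ n * q.2) := by
    intro q _
    simp only [F]
    set M := fermatCount n q
    set N := fermatCount n ((-lam⁻¹) ^ n * q.1, (-lam⁻¹) ^ n * q.2)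
    have hN0 : (0 : ℝ) ≤ N := Nat.cast_nonneg N
    have hM0 : (0 : ℝ) ≤ M := Nat.cast_nonneg M
    have hFM : (0 : ℝ) ≤ if 192 * 1 < M then (M : ℝ) ^ 3 else 0 := by split_ifs <;> positivity
    by_cases h : 192 * 1 < N
    · rw [if_pos h, if_pos h]
      rcases le_or_gt M N with hMN | hMN
      · have hMN' : (M : ℝ) ≤ N := by exact_mod_cast hMN
        have h2 : (M : ℝ) * (N : ℝ) ^ 2 ≤ N * (N : ℝ) ^ 2 := by gcongr
        linarith [h2, pow_succ' (N : ℝ) 2]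
      · rw [if_pos (h.trans hMN)]
        have hMN' : (N : ℝ) ≤ M := by exact_mod_cast hMN.le
        have h2 : (M : ℝ) * (N : ℝ) ^ 2 ≤ M * (M : ℝ) ^ 2 := by gcongr
        have h3 : (0 : ℝ) ≤ (N : ℝ) ^ 3 := by positivity
        linarith [h2, pow_succ' (M : ℝ) 2]
    · rw [if_neg h, if_neg h]
      linarith
  have hs := Finset.sum_le_sum hpt
  rw [Finset.sum_add_distrib, sum_comp_mul_nonzeroPowers hc F] at hs
  have hF : ∑ q ∈ nonzeroPowers p n ×ˢ nonzeroPowers p n, F q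
      ≤ 384 ^ 3 * ((n : ℝ) ^ 2 * (1 + Real.log n)) := by
    simp only [F]
    rw [← Finset.sum_filter]
    exact hrich
  push_cast at hs ⊢
  linarith

theorem abs_shiftedEnergy_sub_le_pow_four {p : ℕ} [Fact p.Prime] (G : Subgroup (ZMod p)ˣ)
    (lam : ZMod p) :
    |(shiftedEnergy G lam : ℝ) - (Nat.card G : ℝ) ^ 4 / p| ≤ (Nat.card G : ℝ) ^ 4 := by
  have h1 : (shiftedEnergy G lam : ℝ) ≤ (Nat.card G : ℝ) ^ 4 := by
    have h : shiftedEnergy G lam ≤ Nat.card G ^ 4 := by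
      refine (Finset.card_filter_le _ _).trans ?_
      simp only [Finset.card_product, card_shiftedSubgroup]
      exact (by ring : _ = Nat.card G ^ 4).le
    exact_mod_cast h
  have hp1 : (1 : ℝ) ≤ p := by exact_mod_cast (Fact.out : p.Prime).one_lt.le
  have h2 : (Nat.card G : ℝ) ^ 4 / p ≤ (Nat.card G : ℝ) ^ 4 := div_le_self (by positivity) hp1
  have h3 : 0 ≤ (Nat.card G : ℝ) ^ 4 / p := by positivity
  have h4 : (0 : ℝ) ≤ shiftedEnergy G lam := Nat.cast_nonneg _
  rw [abs_le]
  constructor <;> linarith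

/-! ### The three ranges -/

theorem one_le_log_of_three_le {p : ℕ} (hp : 3 ≤ p) : 1 ≤ Real.log p := by
  rw [Real.le_log_iff_exp_le (by positivity)]
  have : (3 : ℝ) ≤ p := by exact_mod_cast hp
  linarith [Real.exp_one_lt_d9]

theorem abs_shiftedEnergy_sub_le_of_large {p : ℕ} [Fact p.Prime] (G : Subgroup (ZMod p)ˣ)
    {lam : ZMod p} (hlam : lam ≠ 0) (h : (p : ℝ) ^ (2 / 3 : ℝ) ≤ (Nat.card G : ℝ)) :
    |(shiftedEnergy G lam : ℝ) - (Nat.card G : ℝ) ^ 4 / (p : ℝ)|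
      ≤ 7 * ((p : ℝ) ^ (1 / 2 : ℝ) * (Nat.card G : ℝ) ^ (3 / 2 : ℝ)) := by
  have hlt := card_subgroup_lt G
  have hn0 : 0 < Nat.card G := Nat.card_pos
  have hbd := abs_shiftedEnergy_sub_le_of_le_sq G hlam
  set n := Nat.card G
  have hnp : (n : ℝ) ≤ p := by exact_mod_cast hlt.le
  have hn1 : (1 : ℝ) ≤ n := by exact_mod_cast hn0
  have hp0 : (0 : ℝ) < p := by linarith
  have h1 : (p : ℝ) ≤ (n : ℝ) ^ (3 / 2 : ℝ) := by
    calc (p : ℝ) = ((p : ℝ) ^ (2 / 3 : ℝ)) ^ (3 / 2 : ℝ) := by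
          rw [← Real.rpow_mul hp0.le]; norm_num
      _ ≤ _ := by gcongr
  have h2 : (n : ℝ) ^ (3 / 2 : ℝ) ≤ (n : ℝ) ^ 2 := by
    rw [← Real.rpow_natCast]
    exact Real.rpow_le_rpow_of_exponent_le hn1 (by norm_num)
  have h3 : (n : ℝ) ^ 2 ≤ (p : ℝ) ^ (1 / 2 : ℝ) * (n : ℝ) ^ (3 / 2 : ℝ) := by
    calc (n : ℝ) ^ 2 = (n : ℝ) ^ (1 / 2 : ℝ) * (n : ℝ) ^ (3 / 2 : ℝ) := by
          rw [← Real.rpow_add (by linarith), ← Real.rpow_natCast]; norm_num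
      _ ≤ _ := by gcongr
  have h4 : (p : ℝ) * √p ≤ (p : ℝ) ^ (1 / 2 : ℝ) * (n : ℝ) ^ (3 / 2 : ℝ) := by
    rw [Real.sqrt_eq_rpow, mul_comm]; gcongr
  have := hbd (h1.trans h2)
  linarith

theorem abs_shiftedEnergy_sub_le_of_medium {p : ℕ} [Fact p.Prime] (G : Subgroup (ZMod p)ˣ)
    {lam : ZMod p} (hlam : lam ≠ 0)
    (h : (p : ℝ) ^ (1 / 2 : ℝ) * Real.log (p : ℝ) ≤ (Nat.card G : ℝ)) :
    |(shiftedEnergy G lam : ℝ) - (Nat.card G : ℝ) ^ 4 / (p : ℝ)|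
      ≤ 10 ^ 13 * ((Nat.card G : ℝ) ^ 3 * (p : ℝ) ^ (-(1 / 2) : ℝ)) := by
  have hlt := card_subgroup_lt G
  have hn0 : 0 < Nat.card G := Nat.card_pos
  have hbd1 := abs_shiftedEnergy_sub_le_of_le_sq G hlam
  have hbd2 := fun hp A hA => abs_shiftedEnergy_sub_le_of_rich (A := A) G hlam hp hA
  have htriv := abs_shiftedEnergy_sub_le_pow_four G lam
  set n := Nat.card G
  have hnp : (n : ℝ) ≤ p := by exact_mod_cast hlt.le
  have hn1 : (1 : ℝ) ≤ n := by exact_mod_cast hn0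
  have hp0 : (0 : ℝ) < p := by linarith
  rw [Real.rpow_neg hp0.le, ← Real.sqrt_eq_rpow, ← div_eq_mul_inv]
  rw [← Real.sqrt_eq_rpow] at h
  set s := √(p : ℝ) with hs
  have hs0 : 0 < s := Real.sqrt_pos.2 hp0
  have hss : s * s = p := Real.mul_self_sqrt hp0.le
  rcases lt_or_ge p 3 with hp3 | hp3
  -- `log 2 < 1`, so `p = 2` escapes the general argument
  · have hn : n = 1 := by omega
    rw [hn] at htriv ⊢
    have hs2 : s ≤ 2 := by
      have : (p : ℝ) ≤ 3 := by exact_mod_cast hp3.le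
      nlinarith
    refine htriv.trans ?_
    rw [← mul_div_assoc, le_div_iff₀ hs0]
    norm_num
    linarith
  · have hL := one_le_log_of_three_le hp3
    set L := Real.log (p : ℝ) with hLdef
    have hsn : s ≤ n := by nlinarith
    have hpn : (p : ℝ) ≤ (n : ℝ) ^ 2 := by nlinarith
    set w := (n : ℝ) ^ 3 / s with hw
    have hwL : (n : ℝ) ^ 2 * L ≤ w := by
      rw [hw, le_div_iff₀ hs0]
      nlinarith [mul_le_mul_of_nonneg_left h (sq_nonneg (n : ℝ))]
    have hw1 : (n : ℝ) ^ 2 ≤ w := by nlinarith [sq_nonneg (n : ℝ)]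
    have hw0 : 0 ≤ w := by positivity
    rcases lt_or_ge (p ^ 2) (512 * n ^ 3) with h3 | h3
    · have h4 : (p : ℝ) ^ 2 ≤ 512 * (n : ℝ) ^ 3 := by exact_mod_cast h3.le
      have h5 : (p : ℝ) * s ≤ 512 * w := by
        rw [hw, ← mul_div_assoc, le_div_iff₀ hs0]
        nlinarith
      have := hbd1 hpn
      linarith
    -- `192 A p` is of the order of the claimed bound `w`, and `w ≥ n ^ 2`
    · set A := ⌈w / p⌉₊ with hA
      have hA0 : 0 < A := Nat.ceil_pos.2 (by positivity)
      have hA1 : w / p ≤ A := Nat.le_ceil _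
      have hA2 : (A : ℝ) < w / p + 1 := Nat.ceil_lt_add_one (by positivity)
      have hwA : w ≤ p * A := by rw [div_le_iff₀ hp0] at hA1; linarith
      have hAw : (p : ℝ) * A ≤ w + p := by
        have : (p : ℝ) * A ≤ p * (w / p + 1) := by gcongr
        rwa [mul_add, mul_div_cancel₀ _ hp0.ne', mul_one] at this
      have h6 := hbd2 hpn A hA0 (by exact_mod_cast hw1.trans hwA) h3
      have hlog : Real.log n ≤ L := Real.log_le_log (by linarith) hnp
      have h7 : (n : ℝ) ^ 2 * (1 + Real.log n) ≤ 2 * w := by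
        have : (n : ℝ) ^ 2 * Real.log n ≤ (n : ℝ) ^ 2 * L := by gcongr
        linarith
      linarith

theorem abs_shiftedEnergy_sub_le_of_small {p : ℕ} [Fact p.Prime] (G : Subgroup (ZMod p)ˣ)
    {lam : ZMod p} (hlam : lam ≠ 0)
    (h : (Nat.card G : ℝ) < (p : ℝ) ^ (1 / 2 : ℝ) * Real.log (p : ℝ)) (hn2 : 2 ≤ Nat.card G) :
    |(shiftedEnergy G lam : ℝ) - (Nat.card G : ℝ) ^ 4 / (p : ℝ)|
      ≤ 10 ^ 13 * ((Nat.card G : ℝ) ^ 2 * Real.log (Nat.card G : ℝ)) := by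
  have hlt := card_subgroup_lt G
  have hbd1 := abs_shiftedEnergy_sub_le_of_le_sq G hlam
  have hbd2 := fun hp A hA => abs_shiftedEnergy_sub_le_of_rich (A := A) G hlam hp hA
  have hbd3 := shiftedEnergy_le_of_sq_le G hlam
  have htriv := abs_shiftedEnergy_sub_le_pow_four G lam
  set n := Nat.card G
  have hnp : (n : ℝ) ≤ p := by exact_mod_cast hlt.le
  have hn2' : (2 : ℝ) ≤ n := by exact_mod_cast hn2
  have hp0 : (0 : ℝ) < p := by linarith
  set l := Real.log (n : ℝ) with hl
  have hl2 : 1 / 2 ≤ l := by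
    have : Real.log 2 ≤ l := Real.log_le_log (by norm_num) hn2'
    linarith [Real.log_two_gt_d9]
  have hnl : (n : ℝ) ^ 2 ≤ 2 * ((n : ℝ) ^ 2 * l) := by nlinarith [sq_nonneg (n : ℝ)]
  have hn20 : (0 : ℝ) ≤ (n : ℝ) ^ 2 := sq_nonneg _
  have hL := one_le_log_of_three_le (p := p) (by omega)
  rcases lt_or_ge (n ^ 2) p with hnp2 | hnp2
  · rcases lt_or_ge (p ^ 2) (512 * n ^ 3) with h3 | h3
    · have h4 : n < 512 := by
        by_contra! hcon
        have h5 : (n ^ 2) ^ 2 ≤ p ^ 2 := Nat.pow_le_pow_left hnp2.le 2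
        have h6 : 512 * n ^ 3 ≤ n * n ^ 3 := Nat.mul_le_mul_right _ hcon
        have h7 : (n ^ 2) ^ 2 = n * n ^ 3 := by ring
        omega
      have h5 : (n : ℝ) ≤ 512 := by exact_mod_cast h4.le
      have h6 : (n : ℝ) ^ 4 ≤ 512 ^ 2 * (n : ℝ) ^ 2 := by
        have : (n : ℝ) ^ 2 ≤ 512 ^ 2 := by gcongr
        nlinarith
      linarith
    · have h4 := hbd3 hnp2.le h3
      have h5 : (n : ℝ) ^ 4 / p ≤ (n : ℝ) ^ 2 := by
        rw [div_le_iff₀ hp0]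
        have : (n : ℝ) ^ 2 ≤ p := by exact_mod_cast hnp2.le
        nlinarith
      have h6 : 0 ≤ (n : ℝ) ^ 4 / p := by positivity
      have h7 : (0 : ℝ) ≤ shiftedEnergy G lam := Nat.cast_nonneg _
      rw [abs_le]
      constructor <;> linarith
  · have hpn : (p : ℝ) ≤ (n : ℝ) ^ 2 := by exact_mod_cast hnp2
    set L := Real.log (p : ℝ) with hLdef
    have hLl : L ≤ 2 * l := by
      have : L ≤ Real.log ((n : ℝ) ^ 2) := Real.log_le_log hp0 hpn
      rwa [Real.log_pow] at this
    have hnL : (n : ℝ) ^ 2 * L ≤ 2 * ((n : ℝ) ^ 2 * l) := by nlinarith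
    have hnL1 : (n : ℝ) ^ 2 ≤ (n : ℝ) ^ 2 * L := by nlinarith
    rcases lt_or_ge (p ^ 2) (512 * n ^ 3) with h3 | h3
    · have h4 : (p : ℝ) ^ 2 ≤ 512 * (n : ℝ) ^ 3 := by exact_mod_cast h3.le
      rw [← Real.sqrt_eq_rpow] at h
      set s := √(p : ℝ) with hs
      have hs0 : 0 < s := Real.sqrt_pos.2 hp0
      have hss : s * s = p := Real.mul_self_sqrt hp0.le
      set t := √s with ht
      have ht0 : 0 < t := Real.sqrt_pos.2 hs0
      have htt : t * t = s := Real.mul_self_sqrt hs0.le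
      -- here `p` is bounded: `p ^ 2 < 512 n ^ 3 < 512 p ^ (3 / 2) L ^ 3` and `L ≪ p ^ (1 / 12)`
      have hL3 : L ^ 3 ≤ 1728 * t := by
        have h5 : L ≤ (p : ℝ) ^ (1 / 12 : ℝ) / (1 / 12) := Real.log_le_rpow_div hp0.le (by norm_num)
        have h6 : L ^ 3 ≤ ((p : ℝ) ^ (1 / 12 : ℝ) / (1 / 12)) ^ 3 := by gcongr
        have h7 : ((p : ℝ) ^ (1 / 12 : ℝ)) ^ 3 = t := by
          rw [ht, hs, Real.sqrt_eq_rpow, Real.sqrt_eq_rpow, ← Real.rpow_mul hp0.le,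
            ← Real.rpow_natCast, ← Real.rpow_mul hp0.le]
          norm_num
        rw [div_pow, h7] at h6
        norm_num at h6
        linarith
      have h8 : s ^ 4 ≤ 512 * (s ^ 3 * (1728 * t)) := by
        calc s ^ 4 = (p : ℝ) ^ 2 := by rw [← hss]; ring
          _ ≤ 512 * (n : ℝ) ^ 3 := h4
          _ ≤ 512 * (s * L) ^ 3 := by gcongr
          _ = 512 * (s ^ 3 * L ^ 3) := by ring
          _ ≤ _ := by gcongr
      have h9 : t ≤ 884736 := by
        have h10 : (s ^ 3 * t) * t ≤ (s ^ 3 * t) * 884736 := by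
          calc (s ^ 3 * t) * t = s ^ 4 := by rw [mul_assoc, htt]; ring
            _ ≤ _ := h8
            _ = _ := by ring
        exact le_of_mul_le_mul_left h10 (by positivity)
      have h11 : s ≤ 884736 ^ 2 := by rw [← htt, ← sq]; gcongr
      have h12 : (p : ℝ) * s ≤ (n : ℝ) ^ 2 * 884736 ^ 2 := by gcongr
      have := hbd1 hpn
      linarith
    · set A := ⌈(n : ℝ) ^ 2 * L / p⌉₊ with hA
      have hA0 : 0 < A := Nat.ceil_pos.2 (by positivity)
      have hA1 : (n : ℝ) ^ 2 * L / p ≤ A := Nat.le_ceil _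
      have hA2 : (A : ℝ) < (n : ℝ) ^ 2 * L / p + 1 := Nat.ceil_lt_add_one (by positivity)
      have hwA : (n : ℝ) ^ 2 * L ≤ p * A := by rw [div_le_iff₀ hp0] at hA1; linarith
      have hAw : (p : ℝ) * A ≤ (n : ℝ) ^ 2 * L + p := by
        have : (p : ℝ) * A ≤ p * ((n : ℝ) ^ 2 * L / p + 1) := by gcongr
        rwa [mul_add, mul_div_cancel₀ _ hp0.ne', mul_one] at this
      have h6 := hbd2 hpn A hA0 (by exact_mod_cast hnL1.trans hwA) h3
      linarith

theorem corollary4p1 :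
    (∃ C : ℝ, 0 < C ∧ ∀ (p : ℕ) [Fact p.Prime] (G : Subgroup (ZMod p)ˣ) (lam : ZMod p), lam ≠ 0 →
      ((p : ℝ) ^ (2 / 3 : ℝ) ≤ (Nat.card G : ℝ) →
        |(shiftedEnergy G lam : ℝ) - (Nat.card G : ℝ) ^ 4 / (p : ℝ)|
          ≤ C * ((p : ℝ) ^ (1 / 2 : ℝ) * (Nat.card G : ℝ) ^ (3 / 2 : ℝ))) ∧
      ((Nat.card G : ℝ) < (p : ℝ) ^ (2 / 3 : ℝ) →
        (p : ℝ) ^ (1 / 2 : ℝ) * Real.log (p : ℝ) ≤ (Nat.card G : ℝ) →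
        |(shiftedEnergy G lam : ℝ) - (Nat.card G : ℝ) ^ 4 / (p : ℝ)|
          ≤ C * ((Nat.card G : ℝ) ^ 3 * (p : ℝ) ^ (-(1 / 2) : ℝ))) ∧
      ((Nat.card G : ℝ) < (p : ℝ) ^ (1 / 2 : ℝ) * Real.log (p : ℝ) → 2 ≤ Nat.card G →
        |(shiftedEnergy G lam : ℝ) - (Nat.card G : ℝ) ^ 4 / (p : ℝ)|
          ≤ C * ((Nat.card G : ℝ) ^ 2 * Real.log (Nat.card G : ℝ)))) ∧
    (∀ (p : ℕ → ℕ) [∀ n, Fact (p n).Prime] (G : ∀ n, Subgroup (ZMod (p n))ˣ)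
      (lam : ∀ n, ZMod (p n)), (∀ n, lam n ≠ 0) →
      Tendsto (fun n => (Nat.card (G n) : ℝ) / √((p n : ℝ) * Real.log (p n : ℝ))) atTop atTop →
      (fun n => (shiftedEnergy (G n) (lam n) : ℝ)) ~[atTop]
        (fun n => (Nat.card (G n) : ℝ) ^ 4 / (p n : ℝ))) := by
  refine ⟨⟨10 ^ 13, by norm_num, fun p _ G lam hlam =>
    ⟨fun h => ?_, fun _ h => ?_, fun h h2 => ?_⟩⟩,
    fun p _ G lam hlam hr => ?_⟩
  · refine (abs_shiftedEnergy_sub_le_of_large G hlam h).trans ?_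
    gcongr
    norm_num
  · exact abs_shiftedEnergy_sub_le_of_medium G hlam h
  · exact abs_shiftedEnergy_sub_le_of_small G hlam h h2
  -- with `r = n / √(p log p)`, the three bounds relative to `n ^ 4 / p` are at most a constant
  -- times `r ^ (-1 / 4)`, `2 / r` and `1 / r ^ 2`
  · have hg : Tendsto (fun x : ℝ => 10 ^ 13 * (x ^ (-(1 / 4) : ℝ) + 2 * x⁻¹ + x⁻¹ * x⁻¹)) atTop
        (nhds 0) := by
      have h1 := tendsto_rpow_neg_atTop (y := 1 / 4) (by norm_num)
      have h2 : Tendsto (fun x : ℝ => x⁻¹) atTop (nhds 0) := tendsto_inv_atTop_zero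
      have h3 := ((h1.add (h2.const_mul 2)).add (h2.mul h2)).const_mul (10 ^ 13)
      simpa using h3
    refine IsLittleO.of_bound fun c hc => ?_
    have hev := (hg.comp hr).eventually (gt_mem_nhds hc)
    filter_upwards [hev, hr.eventually_ge_atTop 2] with k hk hk2
    simp only [Function.comp_apply] at hk
    rw [Pi.sub_apply, Real.norm_eq_abs, Real.norm_of_nonneg (by positivity)]
    refine le_trans ?_ (mul_le_mul_of_nonneg_right hk.le (by positivity))
    clear hk hev
    have hlt := card_subgroup_lt (G k)
    have hp2 : (2 : ℝ) ≤ p k := by exact_mod_cast (Fact.out : (p k).Prime).two_le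
    have hlarge := abs_shiftedEnergy_sub_le_of_large (G k) (hlam k)
    have hmedium := abs_shiftedEnergy_sub_le_of_medium (G k) (hlam k)
    have hsmall := abs_shiftedEnergy_sub_le_of_small (G k) (hlam k)
    set n := Nat.card (G k)
    set q : ℝ := (p k : ℝ)
    set L := Real.log q with hL
    set r := (n : ℝ) / √(q * L) with hrdef
    have hL2 : 1 / 2 ≤ L := by
      have : Real.log 2 ≤ L := Real.log_le_log (by norm_num) hp2
      linarith [Real.log_two_gt_d9]
    have hqL : 1 ≤ q * L := by nlinarith
    have hsq : 1 ≤ √(q * L) := Real.one_le_sqrt.2 hqL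
    have hsqsq : √(q * L) * √(q * L) = q * L := Real.mul_self_sqrt (by linarith)
    have hnr : (n : ℝ) = r * √(q * L) := by rw [hrdef]; field_simp
    have hr0 : 0 < r := by linarith
    have hrn : r ≤ n := by rw [hnr]; nlinarith
    have hn2 : (2 : ℝ) ≤ n := by linarith
    have hnq : (n : ℝ) ≤ q := Nat.cast_le.2 hlt.le
    have hq0 : 0 < q := by linarith
    have hn0 : (0 : ℝ) < n := by linarith
    have e1 : 0 ≤ r ^ (-(1 / 4) : ℝ) := by positivity
    have e2 : 0 ≤ 2 * r⁻¹ := by positivity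
    have e3 : 0 ≤ r⁻¹ * r⁻¹ := by positivity
    have hF0 : 0 ≤ (n : ℝ) ^ 4 / q := by positivity
    have hn2sq : (n : ℝ) ^ 2 = r ^ 2 * (q * L) := by rw [hnr, mul_pow, sq √(q * L), hsqsq]
    rcases le_or_gt (q ^ (2 / 3 : ℝ)) n with h1 | h1
    · refine (hlarge h1).trans ?_
      have h2 : q ^ (3 / 2 : ℝ) ≤ (n : ℝ) ^ (9 / 4 : ℝ) := by
        calc q ^ (3 / 2 : ℝ) = (q ^ (2 / 3 : ℝ)) ^ (9 / 4 : ℝ) := by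
              rw [← Real.rpow_mul hq0.le]; norm_num
          _ ≤ _ := by gcongr
      have h3 : (n : ℝ) ^ (-(1 / 4) : ℝ) ≤ r ^ (-(1 / 4) : ℝ) :=
        Real.rpow_le_rpow_of_nonpos hr0 hrn (by norm_num)
      have h4 : q ^ (1 / 2 : ℝ) * (n : ℝ) ^ (3 / 2 : ℝ)
          ≤ (n : ℝ) ^ (-(1 / 4) : ℝ) * ((n : ℝ) ^ 4 / q) := by
        rw [← mul_div_assoc, le_div_iff₀ hq0]
        calc q ^ (1 / 2 : ℝ) * (n : ℝ) ^ (3 / 2 : ℝ) * q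
            = (q ^ (1 / 2 : ℝ) * q ^ (1 : ℝ)) * (n : ℝ) ^ (3 / 2 : ℝ) := by
              rw [Real.rpow_one]; ring
          _ = q ^ (3 / 2 : ℝ) * (n : ℝ) ^ (3 / 2 : ℝ) := by
              rw [← Real.rpow_add hq0]; norm_num
          _ ≤ (n : ℝ) ^ (9 / 4 : ℝ) * (n : ℝ) ^ (3 / 2 : ℝ) := by gcongr
          _ = (n : ℝ) ^ (-(1 / 4) : ℝ) * (n : ℝ) ^ (4 : ℕ) := by
              rw [← Real.rpow_natCast, ← Real.rpow_add hn0, ← Real.rpow_add hn0]; norm_num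
      have h5 : (n : ℝ) ^ (-(1 / 4) : ℝ) * ((n : ℝ) ^ 4 / q)
          ≤ (r ^ (-(1 / 4) : ℝ) + 2 * r⁻¹ + r⁻¹ * r⁻¹) * ((n : ℝ) ^ 4 / q) := by
        gcongr; linarith
      have h6 := h4.trans h5
      have h7 : 0 ≤ (r ^ (-(1 / 4) : ℝ) + 2 * r⁻¹ + r⁻¹ * r⁻¹) * ((n : ℝ) ^ 4 / q) := by positivity
      rw [mul_assoc]
      linarith
    rcases le_or_gt (q ^ (1 / 2 : ℝ) * L) n with h2 | h2
    · refine (hmedium h2).trans ?_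
      rw [mul_assoc]
      refine mul_le_mul_of_nonneg_left ?_ (by norm_num)
      have hs0 : 0 < √q := Real.sqrt_pos.2 hq0
      have hss : √q * √q = q := Real.mul_self_sqrt hq0.le
      have h3 : √q ≤ 2 * √(q * L) := by
        refine Real.sqrt_le_iff.2 ⟨by positivity, ?_⟩
        rw [mul_pow, sq √(q * L), hsqsq]
        nlinarith
      have h4 : √q ≤ 2 * r⁻¹ * n := by
        have : 2 * r⁻¹ * n = 2 * √(q * L) := by rw [hnr]; field_simp
        rw [this]; exact h3
      calc (n : ℝ) ^ 3 * q ^ (-(1 / 2) : ℝ) = (n : ℝ) ^ 3 / √q := by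
            rw [Real.rpow_neg hq0.le, ← Real.sqrt_eq_rpow, div_eq_mul_inv]
        _ = (n : ℝ) ^ 3 * √q / q := by
            rw [div_eq_div_iff hs0.ne' hq0.ne', mul_assoc, hss]
        _ ≤ (n : ℝ) ^ 3 * (2 * r⁻¹ * n) / q := by gcongr
        _ = 2 * r⁻¹ * ((n : ℝ) ^ 4 / q) := by ring
        _ ≤ _ := mul_le_mul_of_nonneg_right (by linarith) hF0
    · refine (hsmall h2 (by exact_mod_cast hn2)).trans ?_
      rw [mul_assoc]
      refine mul_le_mul_of_nonneg_left ?_ (by norm_num)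
      have hlog : Real.log n ≤ L := Real.log_le_log hn0 hnq
      calc (n : ℝ) ^ 2 * Real.log n ≤ (n : ℝ) ^ 2 * L := by gcongr
        _ = r⁻¹ * r⁻¹ * ((n : ℝ) ^ 2 * (r ^ 2 * (q * L)) / q) := by field_simp
        _ = r⁻¹ * r⁻¹ * ((n : ℝ) ^ 4 / q) := by rw [← hn2sq]; ring
        _ ≤ _ := mul_le_mul_of_nonneg_right (by linarith) hF0
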